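/- Let $d\ge 1$, $p\in(d,\infty]$, let $K\subset\mathbb R^d$ be a bounded open convex set, symmetric with respect to the origin and containing it, and let $C\subset\mathbb R^d$ be a non-empty open convex cone. Let $\mu$ be Lebesgue measure, $|x|_K=\inf\{\lambda>0: x\in\lambda K\}$, $|z|_{K^\circ}=\sup\{(x,z): |x|_K\le 1\}$, $p'=p/(p-1)$. Let $W^{1,p}(C)$ be the space of locally integrable $f:C\to\mathbb R$ all of whose first order distributional derivatives belong to $L_p(C)$. A charge on $C$ is a countably additive set function on the Lebesgue measurable subsets of $C$ with values in $[-\infty,\infty]$ that omits at least one of the values $\pm\infty$ (for instance, any real-valued one). For a charge $\nu$ and $h>0$ put $$\|\nu\|_h=\sup_{x\in C}|\nu(x+(hK\cap C))|,\qquad \|\nu\|=\sup_{h>0}\|\nu\|_h .$$ Let $B$ be Euler's beta function and $$A=d^{-1}B^{1/p'}\Bigl(1-\tfrac{(d-1)p'}{d},\,p'+1\Bigr),\quad \alpha=\frac{pd}{p+(p-1)d},\quad a=\Bigl(\frac{(p-d)A}{pd}\Bigr)^{\alpha}\Bigl(\frac{pd}{p-d}+1\Bigr),$$ where for $p=\infty$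 all expressions are understood as their limits as $p\to\infty$ (so $1/p=0$, $p'=1$, $\alpha=d/(1+d)$, $a=(A/d)^{\alpha}(d+1)$). Let $\nu$ be a charge on $C$ that is absolutely continuous with respect to $\mu$ and has a (real-valued) Radon–Nikodym derivative $D_\mu\nu\in W^{1,p}(C)$. (i) For every $h>0$ with $\|\nu\|_h<\infty$, $$\|D_\mu\nu\|_{L_\infty(C)}\le A\,\mu(K\cap C)^{-1/p}h^{1-d/p}\,\bigl\||\nabla D_\mu\nu|_{K^\circ}\bigr\|_{L_p(C)}+\mu(K\cap C)^{-1}h^{-d}\|\nu\|_h .$$ (ii) If $\|\nu\|<\infty$, then $$\|D_\mu\nu\|_{L_\infty(C)}\le a\,\mu(K\cap C)^{-\alpha/d}\,\|\nu\|^{1-\alpha}\,\bigl\||\nabla D_\mu\nu|_{K^\circ}\bigr\|_{L_p(C)}^{\alpha}.$$ (iii) Both inequalities are sharp. For $h>0$ let $g_h(u)=\frac{1}{d\,\mu(K\cap C)}\bigl(\frac1{u^{d-1}}-\frac{u}{h^d}\bigr)$ and let $f_{e,h}(y)=\int_{|y|_K}^h g_h^{p'-1}(u)\,du$ for $y\in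 hK\cap C$, $f_{e,h}(y)=0$ for $y\in C\setminus hK$. Then $f_{e,h}\in W^{1,p}(C)$, $0<\|f_{e,h}\|_{L_\infty(C)}<\infty$, there is a real-valued charge with density $f_{e,h}$, and every charge $\nu$ on $C$ with $D_\mu\nu=f_{e,h}$ satisfies the hypotheses of (i) and (ii) and gives equality in (i) (for this $h$) and in (ii). -/

import Mathlib

open MeasureTheory Set
open scoped ENNReal Pointwise

noncomputable section

namespace ChargeNagy

/-- The Euclidean space `ℝ^d`. -/
abbrev E (d : ℕ) : Type := EuclideanSpace ℝ (Fin d)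

/-- A charge on `C`: a countably additive set function on the Lebesgue measurable subsets of `C`,
with values in `[-∞, ∞]`, that omits at least one of the values `±∞`. Every real-valued countably
additive set function is a charge in this sense. The values of `val` on other sets are irrelevant.
-/
structure Charge {d : ℕ} (C : Set (E d)) where
  val : Set (E d) → EReal
  val_empty : val ∅ = 0
  hasSum_iUnion : ∀ A : ℕ → Set (E d), (∀ n, NullMeasurableSet (A n) volume) → (∀ n, A n ⊆ C) →
    Pairwise (fun i j => Disjoint (A i) (A j)) →
    HasSum (fun n => val (A n)) (val (⋃ n, A n))
  omits : (∀ A, NullMeasurableSet A volume → A ⊆ C → val A ≠ ⊥) ∨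
    (∀ A, NullMeasurableSet A volume → A ⊆ C → val A ≠ ⊤)

namespace Charge

variable {d : ℕ} {C : Set (E d)}

/-- The charge has finite real values only. -/
def IsReal (ν : Charge C) : Prop :=
  ∀ A, NullMeasurableSet A volume → A ⊆ C → ν.val A ≠ ⊥ ∧ ν.val A ≠ ⊤

/-- Absolute continuity with respect to Lebesgue measure. -/
def IsAbsCont (ν : Charge C) : Prop :=
  ∀ A, A ⊆ C → volume A = 0 → ν.val A = 0

/-- `f` is (a version of) the Radon–Nikodym derivative of `ν` with respect to Lebesgue measure on
`C`: `ν A = ∫_A f`, where the integral is `∫_A f⁺ - ∫_A f⁻` in `[-∞, ∞]`. As `ν` omits one of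
`±∞`, this forces one of `∫_C f⁺`, `∫_C f⁻` to be finite, so `∞ - ∞` does not occur. -/
def IsRNDeriv (ν : Charge C) (f : E d → ℝ) : Prop :=
  AEMeasurable f (volume.restrict C) ∧
  ∀ A, NullMeasurableSet A volume → A ⊆ C →
    ν.val A = ((∫⁻ x in A, ENNReal.ofReal (f x) : ℝ≥0∞) : EReal)
      - ((∫⁻ x in A, ENNReal.ofReal (-f x) : ℝ≥0∞) : EReal)

/-- The seminorm `sup_{x ∈ C} |ν (x + (hK ∩ C))|`. -/
def seminormAt (ν : Charge C) (K : Set (E d)) (h : ℝ) : ℝ≥0∞ :=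
  ⨆ x ∈ C, (ν.val (x +ᵥ (h • K ∩ C))).abs

/-- The seminorm `sup_{h > 0} sup_{x ∈ C} |ν (x + (hK ∩ C))|`. -/
def seminorm (ν : Charge C) (K : Set (E d)) : ℝ≥0∞ :=
  ⨆ h : ℝ, ⨆ _ : 0 < h, ν.seminormAt K h

end Charge

variable {d : ℕ}

/-- The norm `|z|_{K°} = sup {(x, z) : |x|_K ≤ 1}` dual to `|x|_K = gauge K x`. -/
def dualNorm (K : Set (E d)) (z : E d) : ℝ :=
  sSup ((fun x => inner ℝ x z) '' {x | gauge K x ≤ 1})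

/-- `G` is (a version of) the distributional gradient of `f` on the open set `C`. -/
def IsWeakGradient (C : Set (E d)) (f : E d → ℝ) (G : E d → E d) : Prop :=
  LocallyIntegrableOn f C volume ∧ LocallyIntegrableOn G C volume ∧
  ∀ φ : E d → ℝ, ContDiff ℝ ((⊤ : ℕ∞) : WithTop ℕ∞) φ → HasCompactSupport φ → tsupport φ ⊆ C →
    ∀ v : E d, ∫ x in C, f x * fderiv ℝ φ x v = - ∫ x in C, inner ℝ (G x) v * φ x

/-- `f ∈ W^{1,p}(C)`: locally integrable on `C`, with all first order distributional derivatives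
in `L_p(C)`. -/
def MemSobolev (C : Set (E d)) (p : ℝ≥0∞) (f : E d → ℝ) : Prop :=
  ∃ G : E d → E d, IsWeakGradient C f G ∧ MemLp G p (volume.restrict C)

/-- The real number `1 / p`, which is `0` for `p = ∞`. -/
def recip (p : ℝ≥0∞) : ℝ := (p⁻¹).toReal

/-- The conjugate exponent `p' = p / (p - 1) = 1 / (1 - 1/p)`, which is `1` for `p = ∞`. -/
def conj (p : ℝ≥0∞) : ℝ := (1 - recip p)⁻¹

/-- The constant `A(d,p) = d⁻¹ B(1 - (d-1)p'/d, p' + 1)^{1/p'}`. -/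
def constA (d : ℕ) (p : ℝ≥0∞) : ℝ :=
  (d : ℝ)⁻¹ *
    ProbabilityTheory.beta (1 - ((d : ℝ) - 1) * conj p / d) (conj p + 1) ^ (1 / conj p)

/-- The exponent `α = pd / (p + (p-1)d) = d / (1 + (1 - 1/p)d)`. -/
def expAlpha (d : ℕ) (p : ℝ≥0∞) : ℝ := d / (1 + (1 - recip p) * d)

/-- The constant `a(d,p) = ((p-d)A(d,p)/(pd))^α (pd/(p-d) + 1)`, where
`(p-d)/(pd) = 1/d - 1/p`. -/
def constSmallA (d : ℕ) (p : ℝ≥0∞) : ℝ :=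
  ((1 / (d : ℝ) - recip p) * constA d p) ^ expAlpha d p * (1 / (1 / (d : ℝ) - recip p) + 1)

/-- `g_h(u) = (u^{-(d-1)} - u h^{-d}) / (d μ(K ∩ C))`. -/
def gFun (K C : Set (E d)) (h u : ℝ) : ℝ :=
  1 / (d * volume.real (K ∩ C)) * (1 / u ^ (d - 1) - u / h ^ d)

open Classical in
/-- The extremal function `f_{e,h}`, equal to `∫_{|y|_K}^h g_h(u)^{p'-1} du` for `y ∈ hK ∩ C` and
to `0` on `C \ hK`. -/
def extremal (p : ℝ≥0∞) (K C : Set (E d)) (h : ℝ) (y : E d) : ℝ :=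
  if y ∈ h • K ∩ C then ∫ u in (gauge K y)..h, gFun K C h u ^ (conj p - 1) else 0

/-- `‖f‖_{L_∞(C)}`. -/
def supNorm (C : Set (E d)) (f : E d → ℝ) : ℝ≥0∞ := eLpNorm f ⊤ (volume.restrict C)

/-- `‖ |G|_{K°} ‖_{L_p(C)}`. -/
def gradNorm (K C : Set (E d)) (p : ℝ≥0∞) (G : E d → E d) : ℝ≥0∞ :=
  eLpNorm (fun x => dualNorm K (G x)) p (volume.restrict C)

/-- The right-hand side of the additive inequality,
`A μ(K ∩ C)^{-1/p} h^{1-d/p} N + μ(K ∩ C)⁻¹ h^{-d} S`. -/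
def additiveBound (p : ℝ≥0∞) (K C : Set (E d)) (h : ℝ) (N S : ℝ≥0∞) : ℝ≥0∞ :=
  ENNReal.ofReal (constA d p * volume.real (K ∩ C) ^ (-recip p) * h ^ (1 - d * recip p)) * N
    + ENNReal.ofReal ((volume.real (K ∩ C))⁻¹ * (h ^ d)⁻¹) * S

/-- The right-hand side of the multiplicative inequality,
`a(d,p) μ(K ∩ C)^{-α/d} S^{1-α} N^α`. -/
def multiplicativeBound (p : ℝ≥0∞) (K C : Set (E d)) (N S : ℝ≥0∞) : ℝ≥0∞ :=
  ENNReal.ofReal (constSmallA d p * volume.real (K ∩ C) ^ (-(expAlpha d p / d)))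
    * S ^ (1 - expAlpha d p) * N ^ expAlpha d p

end ChargeNagy

end

open ChargeNagy

/-!
The additive inequality rests on a pointwise representation. For `y ∈ C` and almost every `x ∈ C`,
`f (x + y) - f x` is the integral of `⟪∇f, y⟫` over the segment `[x, x + y]`
(`IsWeakGradient.ae_sub_eq_integral`); this is checked against test functions, so no smooth
approximation of `f` is needed, and `x + t y` stays in `C` because `C` is a convex cone. Averaging
over `y ∈ hK ∩ C` and substituting `z = t y` bounds the distance of `f x` from its mean over
`x + (hK ∩ C)` by `∫_{hK ∩ C} |∇f (x + z)|_{K°} g_h(|z|_K) dz` (`lintegral_ray_le`,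
`IsWeakGradient.ae_enorm_mul_le`). Hölder's inequality and polar coordinates in the cone
(`IsSymmBody.map_gauge_restrict`), which turn `‖g_h(|·|_K)‖_{p'}` into a beta integral
(`lintegral_gFun_rpow`), give the constant `A`. The mean itself is `ν (x + (hK ∩ C))` divided by
the volume of `hK ∩ C`.

The multiplicative bound is the minimum over `h` of the additive bounds: by the weighted inequality
between arithmetic and geometric means it lies below all of them
(`multiplicativeBound_le_additiveBound`), with equality for one `h` when the gradient norm and the
seminorm are positive (`exists_additive_eq_multiplicative`).

The extremal function is radial, `F(|x|_K)` with `F' = -g_h^{p'-1}`. Its gradient may be unbounded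
near the apex, so its weak differentiability is obtained from Lipschitz truncations
(`isWeakGradient_extremal`), and `|∇|x|_K|_{K°} = 1` almost everywhere. Polar coordinates and the
identity `d μ(K ∩ C) u^{d-1} g_h(u) = 1 - (u/h)^d` show that the two summands of the additive bound
add up to `F(0) = ∫_0^h g_h^{p'-1}` (`extremalProfile_eq_additiveBound`). The density is nonnegative
and vanishes outside `hK`, so both seminorms of the charge equal its total mass
(`seminormAt_eq_seminorm_eq`). Equality in the multiplicative inequality then needs no computation:
the multiplicative bound is at least the supremum norm, and at most the additive bound at `h`, which
equals that norm.
-/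

noncomputable section

namespace ChargeNagy

open Filter Topology

variable {d : ℕ} {K : Set (E d)} {C : ConvexCone ℝ (E d)} {p : ℝ≥0∞} {h : ℝ}

/-! ### The gauge and its dual norm -/

/-- A bounded open convex set, symmetric about the origin and containing it: the open unit ball of
a norm on `ℝ^d`. -/
structure IsSymmBody (K : Set (E d)) : Prop where
  isOpen : IsOpen K
  convex : Convex ℝ K
  isBounded : Bornology.IsBounded K
  neg_mem : ∀ x ∈ K, -x ∈ K
  zero_mem : (0 : E d) ∈ K

namespace IsSymmBody

lemma mem_nhds (hK : IsSymmBody K) : K ∈ 𝓝 (0 : E d) := hK.isOpen.mem_nhds hK.zero_mem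

lemma absorbent (hK : IsSymmBody K) : Absorbent ℝ K := absorbent_nhds_zero hK.mem_nhds

lemma continuous_gauge (hK : IsSymmBody K) : Continuous (gauge K) :=
  _root_.continuous_gauge hK.convex hK.mem_nhds

lemma gauge_pos_iff (hK : IsSymmBody K) {x : E d} : 0 < gauge K x ↔ x ≠ 0 :=
  gauge_pos hK.absorbent (NormedSpace.isVonNBounded_iff ℝ |>.2 hK.isBounded)

lemma mem_smul_iff (hK : IsSymmBody K) {r : ℝ} (hr : 0 < r) {x : E d} :
    x ∈ r • K ↔ gauge K x < r := by
  refine ⟨gauge_lt_of_mem_smul x r hr hK.isOpen, fun hx => ?_⟩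
  have h1 : gauge K (r⁻¹ • x) < 1 := by
    rw [gauge_smul_of_nonneg (by positivity), smul_eq_mul, inv_mul_lt_iff₀ hr]; simpa using hx
  rw [mem_smul_set_iff_inv_smul_mem₀ hr.ne']
  have := setOfPred_gauge_lt_one_eq_self_of_isOpen hK.convex hK.zero_mem hK.isOpen
  rw [← this]; exact h1

lemma exists_norm_le_mul_gauge (hK : IsSymmBody K) : ∃ R : ℝ, 0 < R ∧ ∀ x, ‖x‖ ≤ R * gauge K x := by
  obtain ⟨R, hR0, hR⟩ := hK.isBounded.subset_closedBall_lt 0 (0 : E d)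
  refine ⟨R, hR0, fun x => ?_⟩
  have := le_gauge_of_subset_closedBall hK.absorbent hR0.le hR (x := x)
  rw [div_le_iff₀ hR0] at this
  linarith

lemma bddAbove_dual (hK : IsSymmBody K) (z : E d) :
    BddAbove ((fun x => inner ℝ x z) '' {x | gauge K x ≤ 1}) := by
  obtain ⟨R, hR0, hR⟩ := hK.exists_norm_le_mul_gauge
  refine ⟨R * ‖z‖, ?_⟩
  rintro _ ⟨x, hx, rfl⟩
  refine (real_inner_le_norm x z).trans ?_
  gcongr
  exact (hR x).trans (mul_le_of_le_one_right hR0.le hx)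

lemma inner_le_dualNorm (hK : IsSymmBody K) {x : E d} (hx : gauge K x ≤ 1) (z : E d) :
    inner ℝ x z ≤ dualNorm K z :=
  le_csSup (hK.bddAbove_dual z) ⟨x, hx, rfl⟩

end IsSymmBody

lemma dualNorm_le {z : E d} {b : ℝ} (h : ∀ x, gauge K x ≤ 1 → inner ℝ x z ≤ b) :
    dualNorm K z ≤ b := by
  refine csSup_le ⟨_, 0, by simp [gauge_zero], rfl⟩ ?_
  rintro _ ⟨x, hx, rfl⟩
  exact h x hx

namespace IsSymmBody

lemma dualNorm_nonneg (hK : IsSymmBody K) (z : E d) : 0 ≤ dualNorm K z := by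
  simpa using hK.inner_le_dualNorm (x := 0) (by simp [gauge_zero]) z

lemma inner_le_mul_gauge (hK : IsSymmBody K) (x z : E d) :
    inner ℝ z x ≤ dualNorm K z * gauge K x := by
  rcases eq_or_ne x 0 with rfl | hx
  · simp [gauge_zero]
  have hg := hK.gauge_pos_iff.2 hx
  have h1 : gauge K ((gauge K x)⁻¹ • x) ≤ 1 := by
    rw [gauge_smul_of_nonneg (by positivity), smul_eq_mul, inv_mul_cancel₀ hg.ne']
  have h2 := hK.inner_le_dualNorm h1 z
  rw [inner_smul_left, real_inner_comm] at h2
  simp only [map_inv₀, conj_trivial] at h2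
  rwa [inv_mul_le_iff₀ hg, mul_comm] at h2

lemma abs_inner_le_mul_gauge (hK : IsSymmBody K) (x z : E d) :
    |inner ℝ z x| ≤ dualNorm K z * gauge K x := by
  refine abs_le'.2 ⟨hK.inner_le_mul_gauge x z, ?_⟩
  have := hK.inner_le_mul_gauge (-x) z
  rwa [gauge_neg hK.neg_mem, inner_neg_right] at this

lemma dualNorm_neg (hK : IsSymmBody K) (z : E d) : dualNorm K (-z) = dualNorm K z := by
  have key : ∀ w : E d, dualNorm K (-w) ≤ dualNorm K w := fun w => dualNorm_le fun x hx => by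
    rw [inner_neg_right, ← inner_neg_left]
    exact hK.inner_le_dualNorm (by rwa [gauge_neg hK.neg_mem]) w
  exact le_antisymm (key z) (by simpa using key (-z))

lemma dualNorm_smul (hK : IsSymmBody K) (c : ℝ) (z : E d) :
    dualNorm K (c • z) = |c| * dualNorm K z := by
  have le_of_pos : ∀ a : ℝ, 0 < a → ∀ w : E d, dualNorm K (a • w) ≤ a * dualNorm K w :=
    fun a ha w => dualNorm_le fun x hx => by
      rw [inner_smul_right]
      exact mul_le_mul_of_nonneg_left (hK.inner_le_dualNorm hx w) ha.le
  have eq_of_pos : ∀ a : ℝ, 0 < a → ∀ w : E d, dualNorm K (a • w) = a * dualNorm K w := by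
    intro a ha w
    refine le_antisymm (le_of_pos a ha w) ?_
    have := le_of_pos a⁻¹ (by positivity) (a • w)
    rwa [inv_smul_smul₀ ha.ne', le_inv_mul_iff₀ ha] at this
  rcases lt_trichotomy c 0 with hc | rfl | hc
  · rw [abs_of_neg hc, ← eq_of_pos _ (neg_pos.2 hc), neg_smul, hK.dualNorm_neg]
  · simp only [zero_smul, abs_zero, zero_mul]
    exact le_antisymm (dualNorm_le fun x _ => by simp) (hK.dualNorm_nonneg 0)
  · rw [abs_of_pos hc, eq_of_pos c hc]

lemma continuous_dualNorm (hK : IsSymmBody K) : Continuous (dualNorm K) := by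
  obtain ⟨R, hR0, hR⟩ := hK.exists_norm_le_mul_gauge
  refine (LipschitzWith.of_le_add_mul ⟨R, hR0.le⟩ fun z w => dualNorm_le fun x hx => ?_).continuous
  have h1 : inner ℝ x z = inner ℝ x w + inner ℝ x (z - w) := by rw [inner_sub_right]; ring
  have h2 : inner ℝ x (z - w) ≤ R * ‖z - w‖ := by
    refine (real_inner_le_norm x _).trans ?_
    gcongr
    exact (hR x).trans (mul_le_of_le_one_right hR0.le hx)
  rw [h1, dist_eq_norm]
  exact add_le_add (hK.inner_le_dualNorm hx w) h2

lemma exists_norm_le_mul_dualNorm (hK : IsSymmBody K) :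
    ∃ R : ℝ, 0 < R ∧ ∀ z, ‖z‖ ≤ R * dualNorm K z := by
  obtain ⟨r, hr0, hr⟩ := Metric.mem_nhds_iff.1 hK.mem_nhds
  refine ⟨r⁻¹, by positivity, fun z => ?_⟩
  rcases eq_or_ne z 0 with rfl | hz
  · simpa using mul_nonneg (by positivity) (hK.dualNorm_nonneg 0)
  have hz' := norm_pos_iff.2 hz
  have h1 := mul_gauge_le_norm hr (x := z)
  have h2 := hK.inner_le_mul_gauge z z
  rw [real_inner_self_eq_norm_sq] at h2
  rw [le_inv_mul_iff₀ hr0]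
  have h3 : r * (‖z‖ ^ 2) ≤ dualNorm K z * ‖z‖ := calc
    r * (‖z‖ ^ 2) ≤ r * (dualNorm K z * gauge K z) := by gcongr
    _ = dualNorm K z * (r * gauge K z) := by ring
    _ ≤ _ := by gcongr; exact hK.dualNorm_nonneg z
  nlinarith

/-- The gradient of the norm `gauge K` has dual norm `1` wherever it exists: it is at most `1` by
the triangle inequality, and at least `1` by Euler's relation `⟪∇|x|_K, x⟫ = |x|_K`. -/
lemma dualNorm_gradient_gauge (hK : IsSymmBody K) {x : E d} (hx : x ≠ 0)
    (hd : DifferentiableAt ℝ (gauge K) x) : dualNorm K (gradient (gauge K) x) = 1 := by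
  have hinner : ∀ y, inner ℝ y (gradient (gauge K) x) = fderiv ℝ (gauge K) x y := by
    intro y
    rw [real_inner_comm, gradient, InnerProductSpace.toDual_symm_apply]
  have hline : ∀ y, HasDerivAt (fun t : ℝ => gauge K (x + t • y)) (fderiv ℝ (gauge K) x y) 0 :=
    fun y => hd.hasFDerivAt.hasLineDerivAt y
  refine le_antisymm (dualNorm_le fun y hy => ?_) ?_
  · rw [hinner]
    refine le_of_tendsto (hline y).tendsto_slope_zero_right ?_
    filter_upwards [self_mem_nhdsWithin] with t ht
    have ht : (0 : ℝ) < t := ht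
    simp only [zero_add, zero_smul, add_zero, smul_eq_mul]
    rw [inv_mul_le_iff₀ ht]
    have h1 := gauge_add_le hK.convex hK.absorbent x (t • y)
    rw [gauge_smul_of_nonneg ht.le, smul_eq_mul] at h1
    nlinarith
  · have hg := hK.gauge_pos_iff.2 hx
    have h1 : fderiv ℝ (gauge K) x x = gauge K x := by
      refine (hline x).unique ?_
      have h2 : HasDerivAt (fun t : ℝ => (1 + t) * gauge K x) (gauge K x) 0 := by
        simpa using ((hasDerivAt_id (0 : ℝ)).const_add 1).mul_const (gauge K x)
      refine h2.congr_of_eventuallyEq ?_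
      filter_upwards [eventually_gt_nhds (show (-1 : ℝ) < 0 by norm_num)] with t ht
      rw [show x + t • x = (1 + t) • x by rw [add_smul, one_smul],
        gauge_smul_of_nonneg (by linarith), smul_eq_mul]
    have h2 := hK.inner_le_mul_gauge x (gradient (gauge K) x)
    rw [real_inner_comm, hinner, h1] at h2
    exact le_of_mul_le_mul_right (by linarith) hg

/-! ### Polar coordinates in a cone -/

lemma isOpen_smul_inter (hK : IsSymmBody K) (hC : IsOpen (C : Set (E d))) {r : ℝ} (hr : 0 < r) :
    IsOpen (r • K ∩ C) := (hK.isOpen.smul₀ hr.ne').inter hC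

lemma smul_inter_cone {r : ℝ} (hr : 0 < r) :
    r • K ∩ (C : Set (E d)) = r • (K ∩ (C : Set (E d))) := by
  rw [smul_set_inter₀ hr.ne']
  congr 1
  ext x
  rw [mem_smul_set_iff_inv_smul_mem₀ hr.ne']
  refine ⟨fun hx => C.smul_mem (inv_pos.2 hr) hx, fun hx => ?_⟩
  have := C.smul_mem hr hx
  rwa [smul_inv_smul₀ hr.ne'] at this

lemma volume_inter_pos (hK : IsSymmBody K) (hC : IsOpen (C : Set (E d)))
    (hCn : (C : Set (E d)).Nonempty) : 0 < volume (K ∩ (C : Set (E d))) := by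
  refine (hK.isOpen.inter hC).measure_pos _ ?_
  obtain ⟨c, hc⟩ := hCn
  set t : ℝ := (gauge K c + 1)⁻¹
  have hg := gauge_nonneg (s := K) c
  have ht : 0 < t := by positivity
  refine ⟨t • c, ?_, C.smul_mem ht hc⟩
  have h1 := (hK.mem_smul_iff (r := 1) one_pos (x := t • c)).2 (by
    rw [gauge_smul_of_nonneg ht.le, smul_eq_mul, inv_mul_lt_iff₀ (by positivity)]; linarith)
  rwa [one_smul] at h1

lemma volume_inter_lt_top (hK : IsSymmBody K) : volume (K ∩ (C : Set (E d))) < ⊤ :=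
  (hK.isBounded.subset inter_subset_left).measure_lt_top

lemma volumeReal_inter_pos (hK : IsSymmBody K) (hC : IsOpen (C : Set (E d)))
    (hCn : (C : Set (E d)).Nonempty) : 0 < volume.real (K ∩ (C : Set (E d))) :=
  ENNReal.toReal_pos (hK.volume_inter_pos hC hCn).ne' hK.volume_inter_lt_top.ne

lemma volume_gauge_lt (hK : IsSymmBody K) (hd : 1 ≤ d) (r : ℝ) :
    volume ({x | gauge K x < r} ∩ (C : Set (E d)))
      = ENNReal.ofReal r ^ d * volume (K ∩ (C : Set (E d))) := by
  rcases le_or_gt r 0 with hr | hr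
  · have h1 : {x | gauge K x < r} = ∅ := by
      ext x; simpa using hr.trans (gauge_nonneg x)
    rw [h1, ENNReal.ofReal_of_nonpos hr, zero_pow (by omega)]; simp
  · have h1 : {x | gauge K x < r} = r • K := by
      ext x; exact (hK.mem_smul_iff hr).symm
    rw [h1, smul_inter_cone hr, Measure.addHaar_smul, finrank_euclideanSpace_fin,
      abs_of_nonneg (by positivity), ENNReal.ofReal_pow hr.le]

lemma volume_smul_inter (hK : IsSymmBody K) (hd : 1 ≤ d) {r : ℝ} (hr : 0 < r) :
    volume (r • K ∩ (C : Set (E d)))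
      = ENNReal.ofReal (r ^ d * volume.real (K ∩ (C : Set (E d)))) := by
  rw [show r • K = {x | gauge K x < r} by ext x; exact hK.mem_smul_iff hr,
    hK.volume_gauge_lt hd, ENNReal.ofReal_mul (by positivity), ENNReal.ofReal_pow hr.le,
    ofReal_measureReal hK.volume_inter_lt_top.ne]

/-- Polar coordinates: the image under `gauge K` of Lebesgue measure on the cone has density
`d μ(K ∩ C) u^{d-1}` on the half-line. Both measures give mass `r^d μ(K ∩ C)` to `(-∞, r)`. -/
lemma map_gauge_restrict (hK : IsSymmBody K) (hd : 1 ≤ d) :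
    (volume.restrict (C : Set (E d))).map (gauge K)
      = (volume.restrict (Ioi (0 : ℝ))).withDensity
          (fun u => ENNReal.ofReal (d * volume.real (K ∩ (C : Set (E d))) * u ^ (d - 1))) := by
  have hmeas := hK.continuous_gauge.measurable
  set m := volume (K ∩ (C : Set (E d))) with hm
  have hmtop : m ≠ ⊤ := hK.volume_inter_lt_top.ne
  have left : ∀ r, (volume.restrict (C : Set (E d))).map (gauge K) (Iio r)
      = ENNReal.ofReal r ^ d * m := by
    intro r
    rw [Measure.map_apply hmeas measurableSet_Iio,
      Measure.restrict_apply (hmeas measurableSet_Iio)]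
    exact hK.volume_gauge_lt hd r
  have right : ∀ r, (volume.restrict (Ioi (0 : ℝ))).withDensity
      (fun u => ENNReal.ofReal (d * volume.real (K ∩ (C : Set (E d))) * u ^ (d - 1))) (Iio r)
      = ENNReal.ofReal r ^ d * m := by
    intro r
    rw [withDensity_apply _ measurableSet_Iio, Measure.restrict_restrict measurableSet_Iio]
    rcases le_or_gt r 0 with hr | hr
    · have : Iio r ∩ Ioi (0 : ℝ) = ∅ := by
        ext u; simp only [mem_inter_iff, mem_Iio, mem_Ioi, mem_empty_iff_false, iff_false]
        intro h; linarith [h.1, h.2]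
      rw [this, ENNReal.ofReal_of_nonpos hr, zero_pow (by omega)]; simp
    · rw [Iio_inter_Ioi, ← ofReal_integral_eq_lintegral_ofReal, ← integral_Ioc_eq_integral_Ioo,
        ← intervalIntegral.integral_of_le hr.le, intervalIntegral.integral_const_mul, integral_pow,
        Nat.sub_add_cancel hd, zero_pow (by omega), ← ENNReal.ofReal_pow hr.le,
        show m = ENNReal.ofReal (volume.real (K ∩ (C : Set (E d)))) from
          (ofReal_measureReal hmtop).symm, ← ENNReal.ofReal_mul (by positivity)]
      · congr 1
        have : ((d - 1 : ℕ) : ℝ) + 1 = d := by exact_mod_cast Nat.sub_add_cancel hd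
        have hd0 : (d : ℝ) ≠ 0 := by exact_mod_cast (by omega : d ≠ 0)
        rw [this]
        field_simp
        ring
      · exact ((by fun_prop : Continuous fun u : ℝ =>
          (d * volume.real (K ∩ (C : Set (E d))) * u ^ (d - 1))).integrableOn_Icc).mono_set
            Ioo_subset_Icc_self
      · filter_upwards [ae_restrict_mem measurableSet_Ioo] with u hu
        have := hu.1.le
        have := measureReal_nonneg (μ := volume) (s := K ∩ (C : Set (E d)))
        simp only [Pi.zero_apply]
        positivity
  have fin : ∀ r : ℝ, ENNReal.ofReal r ^ d * m ≠ ⊤ := fun r => by finiteness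
  have : IsLocallyFiniteMeasure ((volume.restrict (C : Set (E d))).map (gauge K)) :=
    ⟨fun x => ⟨Iio (x + 1), Iio_mem_nhds (by linarith), by
      rw [left]; exact (fin _).lt_top⟩⟩
  refine Measure.ext_of_Ico _ _ fun a b hab => ?_
  rw [show Ico a b = Iio b \ Iio a by ext u; simp,
    measure_sdiff (Iio_subset_Iio hab.le) measurableSet_Iio.nullMeasurableSet
      (by rw [left]; exact fin a),
    measure_sdiff (Iio_subset_Iio hab.le) measurableSet_Iio.nullMeasurableSet
      (by rw [right]; exact fin a), left, left, right, right]

lemma lintegral_comp_gauge (hK : IsSymmBody K) (hd : 1 ≤ d) {φ : ℝ → ℝ≥0∞} (hφ : Measurable φ) :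
    ∫⁻ x in (C : Set (E d)), φ (gauge K x) = ∫⁻ u in Ioi (0 : ℝ),
      ENNReal.ofReal (d * volume.real (K ∩ (C : Set (E d))) * u ^ (d - 1)) * φ u := by
  rw [← lintegral_map hφ hK.continuous_gauge.measurable, hK.map_gauge_restrict hd,
    lintegral_withDensity_eq_lintegral_mul _ (by fun_prop) hφ]
  rfl

lemma lintegral_smul_inter_comp_gauge (hK : IsSymmBody K) (hd : 1 ≤ d) {h : ℝ} (hh : 0 < h)
    {φ : ℝ → ℝ≥0∞} (hφ : Measurable φ) :
    ∫⁻ x in h • K ∩ (C : Set (E d)), φ (gauge K x) = ∫⁻ u in Ioo (0 : ℝ) h,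
      ENNReal.ofReal (d * volume.real (K ∩ (C : Set (E d))) * u ^ (d - 1)) * φ u := by
  have h1 := hK.lintegral_comp_gauge (C := C) hd (hφ.indicator (measurableSet_Iio (a := h)))
  have h2 : ∫⁻ x in (C : Set (E d)), (Iio h).indicator φ (gauge K x)
      = ∫⁻ x in h • K ∩ (C : Set (E d)), φ (gauge K x) := by
    rw [← Measure.restrict_restrict (hK.isOpen.smul₀ hh.ne').measurableSet,
      ← lintegral_indicator (hK.isOpen.smul₀ hh.ne').measurableSet]
    congr with x
    simp only [indicator, mem_Iio, hK.mem_smul_iff hh]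
  rw [← h2, h1, ← Iio_inter_Ioi, ← Measure.restrict_restrict measurableSet_Iio,
    ← lintegral_indicator measurableSet_Iio]
  congr with u
  by_cases hu : u < h <;> simp [indicator, hu]

/-- A sphere of the norm `gauge K` is Lebesgue null. -/
lemma ae_gauge_ne (hK : IsSymmBody K) (hd : 1 ≤ d) (r : ℝ) : ∀ᵐ x : E d, gauge K x ≠ r := by
  have h1 := hK.map_gauge_restrict (C := (⊤ : ConvexCone ℝ (E d))) hd
  have h2 : (volume.map (gauge K)) {r} = 0 := by
    have : ((⊤ : ConvexCone ℝ (E d)) : Set (E d)) = univ := rfl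
    rw [this, Measure.restrict_univ] at h1
    rw [h1]
    exact (withDensity_absolutelyContinuous _ _) 
      (Measure.absolutelyContinuous_of_le Measure.restrict_le_self (by simp))
  rw [Measure.map_apply hK.continuous_gauge.measurable (measurableSet_singleton r)] at h2
  exact measure_eq_zero_iff_ae_notMem.1 h2

end IsSymmBody

/-! ### Weak gradients -/

lemma locallyIntegrableOn_congr {F : Type*} [NormedAddCommGroup F] {U : Set (E d)} (hU : IsOpen U)
    {f g : E d → F} (hf : LocallyIntegrableOn f U) (hfg : f =ᵐ[volume.restrict U] g) :
    LocallyIntegrableOn g U := by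
  rw [locallyIntegrableOn_iff hU.isLocallyClosed] at hf ⊢
  intro Q hQU hQ
  exact (hf Q hQU hQ).congr (ae_restrict_of_ae_restrict_of_subset hQU hfg)

lemma IsWeakGradient.congr {U : Set (E d)} (hU : IsOpen U) {f f' : E d → ℝ} {G G' : E d → E d}
    (h : IsWeakGradient U f G) (hf : f =ᵐ[volume.restrict U] f')
    (hG : G =ᵐ[volume.restrict U] G') : IsWeakGradient U f' G' := by
  refine ⟨locallyIntegrableOn_congr hU h.1 hf, locallyIntegrableOn_congr hU h.2.1 hG, ?_⟩
  intro φ h1 h2 h3 v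
  have e1 : ∫ x in U, f' x * fderiv ℝ φ x v = ∫ x in U, f x * fderiv ℝ φ x v :=
    integral_congr_ae (hf.mono fun x hx => by simp only [hx])
  have e2 : ∫ x in U, inner ℝ (G' x) v * φ x = ∫ x in U, inner ℝ (G x) v * φ x :=
    integral_congr_ae (hG.mono fun x hx => by simp only [hx])
  rw [e1, e2, h.2.2 φ h1 h2 h3 v]

lemma integrable_smul_of_locallyIntegrableOn {F : Type*} [NormedAddCommGroup F] [NormedSpace ℝ F]
    {U : Set (E d)} {f : E d → F} (hf : LocallyIntegrableOn f U) {φ : E d → ℝ} (hφ : Continuous φ)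
    (hφc : HasCompactSupport φ) (hφU : tsupport φ ⊆ U) : Integrable (fun x => φ x • f x) := by
  have h1 : IntegrableOn f (tsupport φ) := hf.integrableOn_compact_subset hφU hφc
  have h2 : IntegrableOn (fun x => φ x • f x) (tsupport φ) :=
    h1.continuousOn_smul hφ.continuousOn hφc
  refine (integrableOn_iff_integrable_of_support_subset ?_).1 h2
  intro x hx
  refine subset_tsupport φ ?_
  intro h
  simp [h] at hx

/-- Weak gradients are unique almost everywhere. -/
lemma IsWeakGradient.ae_eq {U : Set (E d)} (hU : IsOpen U) {f : E d → ℝ} {G G' : E d → E d}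
    (h : IsWeakGradient U f G) (h' : IsWeakGradient U f G') : G =ᵐ[volume.restrict U] G' := by
  have key := hU.ae_eq_zero_of_integral_contDiff_smul_eq_zero (μ := volume)
    (f := fun x => G x - G' x) (h.2.1.sub h'.2.1) ?_
  · rw [EventuallyEq, ae_restrict_iff' hU.measurableSet]
    filter_upwards [key] with x hx hxU
    exact sub_eq_zero.1 (hx hxU)
  intro φ hφ hφc hφU
  have i1 := integrable_smul_of_locallyIntegrableOn h.2.1 hφ.continuous hφc hφU
  have i2 := integrable_smul_of_locallyIntegrableOn h'.2.1 hφ.continuous hφc hφU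
  have hz : ∀ x ∉ U, φ x = 0 := fun x hx => image_eq_zero_of_notMem_tsupport fun h => hx (hφU h)
  simp_rw [smul_sub]
  rw [integral_sub i1 i2, sub_eq_zero]
  refine ext_inner_left ℝ fun v => ?_
  have e : ∀ {H : E d → E d}, IsWeakGradient U f H → Integrable (fun x => φ x • H x) →
      inner ℝ v (∫ x, φ x • H x) = - ∫ x in U, f x * fderiv ℝ φ x v := by
    intro H hH hi
    rw [hH.2.2 φ hφ hφc hφU v, neg_neg, ← integral_inner hi]
    rw [setIntegral_eq_integral_of_forall_compl_eq_zero fun x hx => by rw [hz x hx, mul_zero]]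
    congr with x
    rw [inner_smul_right, real_inner_comm, mul_comm]
  rw [e h i1, e h' i2]

lemma integrable_shear {F : Type*} [NormedAddCommGroup F] {g : E d → F} (hg : Integrable g)
    (y : E d) : Integrable (fun q : ℝ × E d => g (q.2 + q.1 • y))
      ((volume.restrict (Ioc (0 : ℝ) 1)).prod volume) := by
  have hmp : MeasurePreserving (fun q : ℝ × E d => (q.1, q.2 + q.1 • y))
      ((volume.restrict (Ioc (0 : ℝ) 1)).prod volume)
      ((volume.restrict (Ioc (0 : ℝ) 1)).prod volume) := by
    refine (MeasurePreserving.id _).skew_product (g := fun (t : ℝ) (x : E d) => x + t • y) ?_ ?_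
    · exact (by fun_prop : Continuous fun q : ℝ × E d => q.2 + q.1 • y).measurable
    · exact Eventually.of_forall fun t => map_add_right_eq_self _ _
  exact hmp.integrable_comp_of_integrable (hg.comp_snd (volume.restrict (Ioc (0 : ℝ) 1)))

lemma cone_add_smul_mem {x y : E d} (hx : x ∈ C) (hy : y ∈ C) {t : ℝ} (ht : 0 ≤ t) :
    x + t • y ∈ C := by
  rcases ht.eq_or_lt with rfl | ht
  · simpa using hx
  · exact C.add_mem hx (C.smul_mem ht hy)

/-- The fundamental theorem of calculus along the segment `[x, x + y]` for almost every `x`: both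
sides have the same integral against every test function. -/
lemma IsWeakGradient.ae_sub_eq_integral (hC : IsOpen (C : Set (E d))) {f : E d → ℝ} {G : E d → E d}
    (h : IsWeakGradient C f G) {y : E d} (hy : y ∈ C) :
    ∀ᵐ x, x ∈ C → f (x + y) - f x = ∫ t in Ioc (0 : ℝ) 1, inner ℝ (G (x + t • y)) y := by
  -- `S Q` is the compact union of the segments `[x, x + y]`, `x ∈ Q`; cutting `f` and `G` off
  -- outside it makes them integrable
  let S : Set (E d) → Set (E d) := fun Q => (fun q : E d × ℝ => q.1 + q.2 • y) '' (Q ×ˢ Icc 0 1)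
  have hSc : ∀ Q, IsCompact Q → IsCompact (S Q) := fun Q hQ =>
    (hQ.prod isCompact_Icc).image (by fun_prop)
  have hSC : ∀ Q ⊆ (C : Set (E d)), S Q ⊆ C := by
    rintro Q hQ _ ⟨⟨x, t⟩, ⟨hx, ht⟩, rfl⟩
    exact cone_add_smul_mem (hQ hx) hy ht.1
  have hmem : ∀ Q, ∀ x ∈ Q, ∀ t ∈ Icc (0 : ℝ) 1, x + t • y ∈ S Q := fun Q x hx t ht =>
    ⟨(x, t), ⟨hx, ht⟩, rfl⟩
  have hmem1 : ∀ Q, ∀ x ∈ Q, x + y ∈ S Q := fun Q x hx => by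
    simpa using hmem Q x hx 1 (by simp)
  have hmem0 : ∀ Q, ∀ x ∈ Q, x ∈ S Q := fun Q x hx => by
    simpa using hmem Q x hx 0 (by simp)
  have hf1 : ∀ Q ⊆ (C : Set (E d)), IsCompact Q → Integrable ((S Q).indicator f) := fun Q h1 h2 =>
    (h.1.integrableOn_compact_subset (hSC Q h1) (hSc Q h2)).integrable_indicator
      (hSc Q h2).measurableSet
  have hG1 : ∀ Q ⊆ (C : Set (E d)), IsCompact Q → Integrable ((S Q).indicator G) := fun Q h1 h2 =>
    (h.2.1.integrableOn_compact_subset (hSC Q h1) (hSc Q h2)).integrable_indicator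
      (hSc Q h2).measurableSet
  have hH1 : ∀ Q ⊆ (C : Set (E d)), IsCompact Q →
      Integrable (fun q : ℝ × E d => inner ℝ ((S Q).indicator G (q.2 + q.1 • y)) y)
        ((volume.restrict (Ioc (0 : ℝ) 1)).prod volume) := fun Q h1 h2 =>
    (integrable_shear (hG1 Q h1 h2) y).inner_const y
  have hHcut : ∀ Q, ∀ x ∈ Q, ∫ t in Ioc (0 : ℝ) 1, inner ℝ (G (x + t • y)) y
      = ∫ t in Ioc (0 : ℝ) 1, inner ℝ ((S Q).indicator G (x + t • y)) y := by
    intro Q x hx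
    refine setIntegral_congr_fun measurableSet_Ioc fun t ht => ?_
    simp only [indicator_of_mem (hmem Q x hx t ⟨ht.1.le, ht.2⟩)]
  have key := hC.ae_eq_zero_of_integral_contDiff_smul_eq_zero (μ := volume)
    (f := fun x => f (x + y) - f x - ∫ t in Ioc (0 : ℝ) 1, inner ℝ (G (x + t • y)) y) ?_ ?_
  · filter_upwards [key] with x hx hxC
    exact sub_eq_zero.1 (hx hxC)
  · rw [locallyIntegrableOn_iff hC.isLocallyClosed]
    intro Q hQC hQ
    have i := ((hf1 Q hQC hQ).comp_add_right y).sub (hf1 Q hQC hQ) |>.sub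
      (hH1 Q hQC hQ).integral_prod_right
    refine (i.integrableOn (s := Q)).congr_fun (fun x hx => ?_) hQ.measurableSet
    simp only [Pi.sub_apply, indicator_of_mem (hmem1 Q x hx), indicator_of_mem (hmem0 Q x hx),
      hHcut Q x hx]
  intro φ hφ hφc hφC
  set Q := tsupport φ with hQ
  set f₁ := (S Q).indicator f with hf₁
  set G₁ := (S Q).indicator G with hG₁
  have if₁ : Integrable f₁ := hf1 Q hφC hφc
  have iH := hH1 Q hφC hφc
  obtain ⟨M, hM⟩ := hφc.exists_bound_of_continuous hφ.continuous
  have hφ' : Continuous (fun x => fderiv ℝ φ x y) :=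
    (hφ.continuous_fderiv (by simp)).clm_apply continuous_const
  obtain ⟨M', hM'⟩ := (hφc.fderiv_apply ℝ y).exists_bound_of_continuous hφ'
  have hzero : ∀ x ∉ Q, φ x = 0 := fun x hx => image_eq_zero_of_notMem_tsupport hx
  -- the part of the integrand that carries `G`
  have eH : ∫ x, φ x * ∫ t in Ioc (0 : ℝ) 1, inner ℝ (G₁ (x + t • y)) y
      = - ∫ w, f₁ w * (φ w - φ (w - y)) := by
    have step1 : ∫ x, φ x * ∫ t in Ioc (0 : ℝ) 1, inner ℝ (G₁ (x + t • y)) y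
        = ∫ t in Ioc (0 : ℝ) 1, ∫ x, φ x * inner ℝ (G₁ (x + t • y)) y := by
      rw [integral_integral_swap]
      · congr with x
        rw [integral_const_mul]
      · exact iH.bdd_mul (f := fun q : ℝ × E d => φ q.2) (c := M)
          (hφ.continuous.comp continuous_snd).aestronglyMeasurable
          (Eventually.of_forall fun q => hM q.2)
    have step2 : ∀ t ∈ Ioc (0 : ℝ) 1, ∫ x, φ x * inner ℝ (G₁ (x + t • y)) y
        = - ∫ w, f₁ w * fderiv ℝ φ (w - t • y) y := by
      intro t ht
      have ht' : t ∈ Icc (0 : ℝ) 1 := ⟨ht.1.le, ht.2⟩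
      let ψ : E d → ℝ := fun w => φ (w - t • y)
      have hψs : ∀ w, ψ w ≠ 0 → w ∈ S Q := by
        intro w hw
        have := hmem Q (w - t • y) (by by_contra hc; exact hw (hzero _ hc)) t ht'
        simpa using this
      have hψt : tsupport ψ ⊆ S Q := closure_minimal hψs (hSc Q hφc).isClosed
      have hψd : ∀ w, fderiv ℝ ψ w = fderiv ℝ φ (w - t • y) := fun w => by
        simp only [ψ, sub_eq_add_neg, fderiv_comp_add_right]
      have hweak := h.2.2 ψ (hφ.comp (contDiff_id.sub contDiff_const))
        (HasCompactSupport.of_support_subset_isCompact (hSc Q hφc) hψs)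
        (hψt.trans (hSC Q hφC)) y
      have hψz : ∀ w ∉ S Q, ψ w = 0 := fun w hw => by
        by_contra hc; exact hw (hψs w hc)
      have hψz' : ∀ w ∉ S Q, fderiv ℝ ψ w = 0 := fun w hw => by
        by_contra hc; exact hw (hψt (support_fderiv_subset ℝ hc))
      calc ∫ x, φ x * inner ℝ (G₁ (x + t • y)) y
          = ∫ w, ψ w * inner ℝ (G₁ w) y := by
            rw [← integral_add_right_eq_self (fun w => ψ w * inner ℝ (G₁ w) y) (t • y)]
            simp only [ψ, add_sub_cancel_right]
        _ = ∫ w in C, inner ℝ (G w) y * ψ w := by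
            rw [setIntegral_eq_integral_of_forall_compl_eq_zero fun w hw => by
              rw [hψz w (fun hc => hw (hSC Q hφC hc)), mul_zero]]
            congr with w
            by_cases hw : w ∈ S Q
            · rw [hG₁, indicator_of_mem hw, mul_comm]
            · rw [hψz w hw, mul_zero, zero_mul]
        _ = - ∫ w in C, f w * fderiv ℝ ψ w y := by rw [hweak, neg_neg]
        _ = - ∫ w, f₁ w * fderiv ℝ φ (w - t • y) y := by
            rw [setIntegral_eq_integral_of_forall_compl_eq_zero fun w hw => by
              rw [hψz' w (fun hc => hw (hSC Q hφC hc))]; simp]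
            congr 2 with w
            by_cases hw : w ∈ S Q
            · rw [hf₁, indicator_of_mem hw, hψd]
            · rw [← hψd, hψz' w hw]; simp
    have step3 : ∀ w, ∫ t in Ioc (0 : ℝ) 1, fderiv ℝ φ (w - t • y) y = φ w - φ (w - y) := by
      intro w
      have hd : ∀ t : ℝ,
          HasDerivAt (fun t : ℝ => - φ (w - t • y)) (fderiv ℝ φ (w - t • y) y) t := by
        intro t
        have h1 := (hφ.differentiable (by simp) (w - t • y)).hasFDerivAt
        have h2 : HasDerivAt (fun t : ℝ => w - t • y) (-y) t := by
          simpa using ((hasDerivAt_id t).smul_const y).const_sub w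
        have h3 := (h1.comp_hasDerivAt t h2).neg
        rw [map_neg, neg_neg] at h3
        exact h3
      rw [← intervalIntegral.integral_of_le zero_le_one,
        intervalIntegral.integral_eq_sub_of_hasDerivAt (fun t _ => hd t)
          ((hφ'.comp (by fun_prop : Continuous fun t : ℝ => w - t • y)).intervalIntegrable _ _)]
      simp
      ring
    rw [step1, setIntegral_congr_fun measurableSet_Ioc step2, integral_neg, integral_integral_swap]
    · congr 2 with w
      rw [integral_const_mul, step3]
    · refine (if₁.comp_snd (volume.restrict (Ioc (0 : ℝ) 1))).mul_bdd (c := M')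
        (g := fun q : ℝ × E d => fderiv ℝ φ (q.2 - q.1 • y) y) ?_ ?_
      · exact (hφ'.comp (by fun_prop : Continuous fun q : ℝ × E d =>
          q.2 - q.1 • y)).aestronglyMeasurable
      · exact Eventually.of_forall fun q => hM' _
  have ia : Integrable fun x => φ x * f₁ (x + y) :=
    (if₁.comp_add_right y).bdd_mul (c := M) hφ.continuous.aestronglyMeasurable
      (Eventually.of_forall hM)
  have ib : Integrable fun x => φ x * f₁ x :=
    if₁.bdd_mul (c := M) hφ.continuous.aestronglyMeasurable (Eventually.of_forall hM)
  have ic : Integrable fun x => φ x * ∫ t in Ioc (0 : ℝ) 1, inner ℝ (G₁ (x + t • y)) y :=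
    iH.integral_prod_right.bdd_mul (c := M) hφ.continuous.aestronglyMeasurable
      (Eventually.of_forall hM)
  have ia' : Integrable fun w => f₁ w * φ (w - y) := by
    simpa [mul_comm] using ia.comp_sub_right y
  have iab : Integrable fun x => φ x * f₁ (x + y) - φ x * f₁ x := ia.sub ib
  have split : ∀ x, φ x • (f (x + y) - f x - ∫ t in Ioc (0 : ℝ) 1, inner ℝ (G (x + t • y)) y)
      = φ x * f₁ (x + y) - φ x * f₁ x
        - φ x * ∫ t in Ioc (0 : ℝ) 1, inner ℝ (G₁ (x + t • y)) y := by
    intro x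
    by_cases hx : x ∈ Q
    · rw [hf₁, indicator_of_mem (hmem1 Q x hx), indicator_of_mem (hmem0 Q x hx), hHcut Q x hx,
        smul_eq_mul]
      ring
    · simp [hzero x hx]
  have ea : ∫ x, φ x * f₁ (x + y) = ∫ w, f₁ w * φ (w - y) := by
    rw [← integral_add_right_eq_self (fun w => f₁ w * φ (w - y)) y]
    simp only [add_sub_cancel_right, mul_comm]
  have eb : ∫ w, f₁ w * (φ w - φ (w - y)) = (∫ x, φ x * f₁ x) - ∫ w, f₁ w * φ (w - y) := by
    rw [← integral_sub ib ia']
    congr with w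
    ring
  rw [integral_congr_ae (Eventually.of_forall split), integral_sub iab ic,
    integral_sub ia ib, eH, ea, eb]
  ring

/-- For almost all pairs of points of the cone, the increment of `f` is controlled by the dual norm
of the weak gradient on the segment between them. -/
lemma IsWeakGradient.ae_enorm_sub_le (hK : IsSymmBody K) (hC : IsOpen (C : Set (E d)))
    {f : E d → ℝ} {G : E d → E d} (h : IsWeakGradient C f G) (hf : Measurable f)
    (hG : Measurable G) :
    ∀ᵐ x ∂volume.restrict (C : Set (E d)), ∀ᵐ y ∂volume.restrict (C : Set (E d)),
      ‖f (x + y) - f x‖ₑ ≤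
        ∫⁻ t in Ioo (0 : ℝ) 1, ENNReal.ofReal (dualNorm K (G (x + t • y)) * gauge K y) := by
  have hN := hK.continuous_dualNorm.measurable
  have hg := hK.continuous_gauge.measurable
  have hmeas : MeasurableSet {q : E d × E d | ‖f (q.1 + q.2) - f q.1‖ₑ ≤
      ∫⁻ t in Ioo (0 : ℝ) 1, ENNReal.ofReal (dualNorm K (G (q.1 + t • q.2)) * gauge K q.2)} := by
    refine measurableSet_le (by fun_prop) (Measurable.lintegral_prod_right' (f := fun r :
      (E d × E d) × ℝ => ENNReal.ofReal (dualNorm K (G (r.1.1 + r.2 • r.1.2)) * gauge K r.1.2)) ?_)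
    have : Measurable fun r : (E d × E d) × ℝ => r.1.1 + r.2 • r.1.2 := by fun_prop
    exact ((hN.comp (hG.comp this)).mul (hg.comp (by fun_prop))).ennreal_ofReal
  rw [Measure.ae_ae_comm hmeas]
  refine (ae_restrict_iff' hC.measurableSet).2 (Eventually.of_forall fun y hy => ?_)
  refine (ae_restrict_iff' hC.measurableSet).2 ?_
  filter_upwards [h.ae_sub_eq_integral hC hy] with x hx hxC
  rw [hx hxC, restrict_Ioo_eq_restrict_Ioc]
  refine (enorm_integral_le_lintegral_enorm _).trans (lintegral_mono fun t => ?_)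
  rw [Real.enorm_eq_ofReal_abs]
  exact ENNReal.ofReal_le_ofReal (hK.abs_inner_le_mul_gauge _ _)

/-! ### Exponents -/

lemma recip_nonneg (p : ℝ≥0∞) : 0 ≤ recip p := ENNReal.toReal_nonneg

lemma recip_lt (hd : 1 ≤ d) (hp : (d : ℝ≥0∞) < p) : recip p < 1 / d := by
  have hd0 : (0 : ℝ) < d := by exact_mod_cast hd
  have h1 : p⁻¹ < (d : ℝ≥0∞)⁻¹ := ENNReal.inv_lt_inv.2 hp
  have h2 := (ENNReal.toReal_lt_toReal h1.ne_top (by simp; omega)).2 h1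
  simpa [recip, ENNReal.toReal_inv] using h2

lemma mul_recip_lt_one (hd : 1 ≤ d) (hp : (d : ℝ≥0∞) < p) : d * recip p < 1 := by
  have hd0 : (0 : ℝ) < d := by exact_mod_cast hd
  have := recip_lt hd hp
  rwa [lt_div_iff₀ hd0, mul_comm] at this

lemma recip_lt_one (hd : 1 ≤ d) (hp : (d : ℝ≥0∞) < p) : recip p < 1 := by
  have hd1 : (1 : ℝ) ≤ d := by exact_mod_cast hd
  nlinarith [mul_recip_lt_one hd hp, recip_nonneg p]

lemma one_le_conj (hd : 1 ≤ d) (hp : (d : ℝ≥0∞) < p) : 1 ≤ conj p := by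
  have h1 := recip_lt_one hd hp
  have h2 := recip_nonneg p
  rw [conj, one_le_inv₀ (by linarith)]
  linarith

lemma conj_pos (hd : 1 ≤ d) (hp : (d : ℝ≥0∞) < p) : 0 < conj p :=
  one_pos.trans_le (one_le_conj hd hp)

lemma one_div_conj (p : ℝ≥0∞) : 1 / conj p = 1 - recip p := by rw [conj, one_div, inv_inv]

lemma conj_mul_one_sub_recip (hd : 1 ≤ d) (hp : (d : ℝ≥0∞) < p) :
    conj p * (1 - recip p) = 1 := by
  rw [← one_div_conj, mul_one_div_cancel (conj_pos hd hp).ne']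

lemma beta_arg_pos (hd : 1 ≤ d) (hp : (d : ℝ≥0∞) < p) :
    0 < 1 - ((d : ℝ) - 1) * conj p / d := by
  have hd0 : (0 : ℝ) < d := by exact_mod_cast hd
  have h1 := conj_mul_one_sub_recip hd hp
  have h2 := conj_pos hd hp
  have h3 := mul_recip_lt_one hd hp
  have : ((d : ℝ) - 1) * conj p / d < 1 := by
    rw [div_lt_one hd0]
    have : (d : ℝ) = d * (conj p * (1 - recip p)) := by rw [h1, mul_one]
    nlinarith
  linarith

lemma constA_pos (hd : 1 ≤ d) (hp : (d : ℝ≥0∞) < p) : 0 < constA d p := by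
  have hd0 : (0 : ℝ) < d := by exact_mod_cast hd
  exact mul_pos (by positivity) (Real.rpow_pos_of_pos (ProbabilityTheory.beta_pos
    (beta_arg_pos hd hp) (by linarith [conj_pos hd hp])) _)

lemma holderConjugate_ofReal_conj (hd : 1 ≤ d) (hp : (d : ℝ≥0∞) < p) :
    p.HolderConjugate (ENNReal.ofReal (conj p)) := by
  rw [ENNReal.holderConjugate_iff]
  have hp0 : p ≠ 0 := (pos_of_gt hp).ne'
  rw [← ENNReal.ofReal_inv_of_pos (conj_pos hd hp), conj, inv_inv,
    ENNReal.ofReal_sub _ (recip_nonneg p), recip, ENNReal.ofReal_toReal (by simpa using hp0),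
    ENNReal.ofReal_one]
  refine add_tsub_cancel_of_le (ENNReal.inv_le_one.2 (le_trans ?_ hp.le))
  exact_mod_cast hd

/-! ### The kernel `g_h` -/

lemma measurable_gFun (K C : Set (E d)) (h : ℝ) : Measurable (gFun K C h) := by
  unfold gFun; fun_prop

lemma gFun_eq (hd : 1 ≤ d) {m h u : ℝ} (hm : volume.real (K ∩ (C : Set (E d))) = m) (hh : 0 < h)
    (hu : 0 < u) :
    gFun K C h u = (d * m * u ^ (d - 1))⁻¹ * (1 - (u / h) ^ d) := by
  rw [gFun, hm]
  obtain ⟨n, rfl⟩ : ∃ n, d = n + 1 := ⟨d - 1, by omega⟩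
  simp only [Nat.add_sub_cancel, div_pow]
  field_simp
  ring

lemma gFun_pos (hd : 1 ≤ d) {h u : ℝ} (hm : 0 < volume.real (K ∩ (C : Set (E d)))) (hu : 0 < u)
    (huh : u < h) : 0 < gFun K C h u := by
  have hh := hu.trans huh
  have hd0 : (0 : ℝ) < d := by exact_mod_cast hd
  rw [gFun_eq hd rfl hh hu]
  have : (u / h) ^ d < 1 := pow_lt_one₀ (by positivity) ((div_lt_one hh).2 huh) (by omega)
  have : 0 < 1 - (u / h) ^ d := by linarith
  positivity

/-- `d μ(K ∩ C) u^{d-1} g_h(u) = 1 - (u / h)^d`. -/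
lemma density_mul_gFun (hd : 1 ≤ d) {h u : ℝ} (hm : 0 < volume.real (K ∩ (C : Set (E d))))
    (hh : 0 < h) (hu : 0 < u) :
    d * volume.real (K ∩ (C : Set (E d))) * u ^ (d - 1) * gFun K C h u = 1 - (u / h) ^ d := by
  have hd0 : (0 : ℝ) < d := by exact_mod_cast hd
  rw [gFun_eq hd rfl hh hu, mul_inv_cancel_left₀ (by positivity)]

lemma lintegral_beta_kernel {a b : ℝ} (ha : 0 < a) (hb : 0 < b) :
    ∫⁻ s in Ioo (0 : ℝ) 1, ENNReal.ofReal (s ^ (a - 1) * (1 - s) ^ (b - 1))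
      = ENNReal.ofReal (ProbabilityTheory.beta a b) := by
  have hB := ProbabilityTheory.beta_pos ha hb
  have h1 := ProbabilityTheory.lintegral_betaPDF_eq_one ha hb
  rw [ProbabilityTheory.lintegral_betaPDF] at h1
  simp_rw [mul_assoc, ENNReal.ofReal_mul (one_div_pos.2 hB).le] at h1
  rw [lintegral_const_mul _ (by fun_prop)] at h1
  rw [one_div, ENNReal.ofReal_inv_of_pos hB] at h1
  have h2 := ENNReal.eq_inv_of_mul_eq_one_left (mul_comm _ _ |>.trans h1)
  rwa [inv_inv] at h2

/-- The substitution `s = (u/h)^d` turns the `L_{p'}` norm of the kernel into a beta integral. -/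
lemma lintegral_gFun_rpow (hd : 1 ≤ d) (hp : (d : ℝ≥0∞) < p) {h : ℝ} (hh : 0 < h)
    (hm : 0 < volume.real (K ∩ (C : Set (E d)))) :
    ∫⁻ u in Ioo 0 h, ENNReal.ofReal (d * volume.real (K ∩ (C : Set (E d))) * u ^ (d - 1))
        * ENNReal.ofReal (gFun K C h u) ^ conj p
      = ENNReal.ofReal ((constA d p * volume.real (K ∩ (C : Set (E d))) ^ (-recip p)
          * h ^ (1 - d * recip p)) ^ conj p) := by
  set m := volume.real (K ∩ (C : Set (E d))) with hmdef
  set q := conj p with hq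
  have hq0 : 0 < q := conj_pos hd hp
  have hd0 : (0 : ℝ) < d := by exact_mod_cast hd
  have hr : recip p = 1 - q⁻¹ := by rw [hq, conj, inv_inv]; ring
  set a : ℝ := 1 - ((d : ℝ) - 1) * q / d with ha
  have ha0 : 0 < a := beta_arg_pos hd hp
  set B := ProbabilityTheory.beta a (q + 1) with hB
  have hB0 : 0 < B := ProbabilityTheory.beta_pos ha0 (by linarith)
  set c : ℝ := m * h ^ d * (d * m) ^ (-q) * h ^ (-((d - 1) * q)) with hc
  have hc0 : 0 ≤ c := by positivity
  have himage : (fun u : ℝ => (u / h) ^ d) '' Ioo 0 h = Ioo 0 1 := by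
    ext s
    constructor
    · rintro ⟨u, hu, rfl⟩
      exact ⟨by have := hu.1; positivity, pow_lt_one₀ (div_nonneg hu.1.le hh.le)
        ((div_lt_one hh).2 hu.2) (by omega)⟩
    · rintro ⟨hs0, hs1⟩
      refine ⟨h * s ^ ((d : ℝ)⁻¹), ⟨by positivity, ?_⟩, ?_⟩
      · have : s ^ ((d : ℝ)⁻¹) < 1 := Real.rpow_lt_one hs0.le hs1 (by positivity)
        nlinarith
      · simp only [mul_div_cancel_left₀ _ hh.ne']
        exact Real.rpow_inv_natCast_pow hs0.le (by omega)
  have hsubst := lintegral_image_eq_lintegral_abs_deriv_mul (s := Ioo (0 : ℝ) h)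
    (f := fun u => (u / h) ^ d) (f' := fun u => d * (u / h) ^ (d - 1) * (1 / h)) measurableSet_Ioo
    (fun u _ => by
      exact (((hasDerivAt_id u).div_const h).pow d).hasDerivWithinAt)
    (by
      intro u hu v hv huv
      have := (pow_left_inj₀ (div_nonneg hu.1.le hh.le) (div_nonneg hv.1.le hh.le)
        (by omega : d ≠ 0)).1 huv
      field_simp at this
      exact this)
    (fun s => ENNReal.ofReal (s ^ (a - 1) * (1 - s) ^ (q + 1 - 1)))
  rw [himage, lintegral_beta_kernel ha0 (by linarith)] at hsubst
  have hpt : ∀ u ∈ Ioo 0 h, ENNReal.ofReal (d * m * u ^ (d - 1))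
      * ENNReal.ofReal (gFun K C h u) ^ q = ENNReal.ofReal c *
        (ENNReal.ofReal |d * (u / h) ^ (d - 1) * (1 / h)| *
          ENNReal.ofReal (((u / h) ^ d) ^ (a - 1) * (1 - (u / h) ^ d) ^ (q + 1 - 1))) := by
    intro u hu
    have hu0 := hu.1
    have hg := gFun_pos hd hm hu.1 hu.2
    have hw : 0 < u / h := by positivity
    have hw1 : (u / h) ^ d < 1 := pow_lt_one₀ hw.le ((div_lt_one hh).2 hu.2) (by omega)
    rw [abs_of_nonneg (by positivity), ENNReal.ofReal_rpow_of_nonneg hg.le hq0.le,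
      ← ENNReal.ofReal_mul (by positivity), ← ENNReal.ofReal_mul (by positivity),
      ← ENNReal.ofReal_mul hc0, gFun_eq hd rfl hh hu0]
    congr 1
    rw [Real.mul_rpow (by positivity) (by linarith), add_sub_cancel_right]
    have e1 : ((u / h) ^ d) ^ (a - 1) = ((u / h) ^ (d - 1)) ^ (-q) := by
      rw [← Real.rpow_natCast, ← Real.rpow_natCast, ← Real.rpow_mul hw.le, ← Real.rpow_mul hw.le]
      congr 1
      rw [ha, Nat.cast_sub hd, Nat.cast_one]
      field_simp
      ring
    have e2 : h ^ (-((d - 1) * q)) = (h ^ (d - 1)) ^ (-q) := by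
      rw [← Real.rpow_natCast h (d - 1), ← Real.rpow_mul hh.le, Nat.cast_sub hd, Nat.cast_one]
      congr 1
      ring
    have e3 : (d * m * u ^ (d - 1))⁻¹ ^ q
        = (d * m) ^ (-q) * ((h ^ (d - 1)) ^ (-q) * ((u / h) ^ (d - 1)) ^ (-q)) := by
      rw [← Real.mul_rpow (by positivity) (by positivity), ← Real.mul_rpow (by positivity)
        (by positivity), Real.inv_rpow (by positivity), ← Real.rpow_neg (by positivity)]
      congr 1
      rw [← mul_pow, mul_div_cancel₀ _ hh.ne']
    have e4 : u ^ (d - 1) = h ^ d * ((u / h) ^ (d - 1) * (1 / h)) := by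
      obtain ⟨n, hn⟩ : ∃ n, d = n + 1 := ⟨d - 1, by omega⟩
      rw [hn, Nat.add_sub_cancel, div_pow]
      field_simp
      ring
    rw [← hmdef, e1, e3, hc, e2, e4]
    ring
  rw [setLIntegral_congr_fun measurableSet_Ioo hpt, lintegral_const_mul' _ _ ENNReal.ofReal_ne_top,
    ← hsubst, ← ENNReal.ofReal_mul hc0]
  congr 1
  rw [constA, ← hq, ← ha, ← hB, Real.mul_rpow (by positivity) (by positivity),
    Real.mul_rpow (by positivity) (by positivity), Real.mul_rpow (by positivity) (by positivity),
    ← Real.rpow_mul hB0.le, ← Real.rpow_mul hm.le, ← Real.rpow_mul hh.le,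
    one_div_mul_cancel hq0.ne', Real.rpow_one, hc, hr, Real.mul_rpow hd0.le hm.le,
    Real.inv_rpow hd0.le, ← Real.rpow_neg hd0.le]
  have e1 : m ^ (-(1 - q⁻¹) * q) = m * m ^ (-q) := by
    rw [show -(1 - q⁻¹) * q = 1 + -q by field_simp; ring, Real.rpow_add hm, Real.rpow_one]
  have e2 : h ^ ((1 - d * (1 - q⁻¹)) * q) = h ^ d * h ^ (-((d - 1) * q)) := by
    rw [← Real.rpow_natCast h d, ← Real.rpow_add hh]
    congr 1
    field_simp
    ring
  rw [e1, e2]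
  ring

lemma lintegral_gFun_comp_gauge (hK : IsSymmBody K) (hd : 1 ≤ d)
    (hp : (d : ℝ≥0∞) < p) {h : ℝ} (hh : 0 < h) (hm : 0 < volume.real (K ∩ (C : Set (E d)))) :
    ∫⁻ x in h • K ∩ (C : Set (E d)), ENNReal.ofReal (gFun K C h (gauge K x)) ^ conj p
      = ENNReal.ofReal ((constA d p * volume.real (K ∩ (C : Set (E d))) ^ (-recip p)
          * h ^ (1 - d * recip p)) ^ conj p) := by
  rw [hK.lintegral_smul_inter_comp_gauge hd hh
    (φ := fun u => ENNReal.ofReal (gFun K C h u) ^ conj p)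
    ((measurable_gFun K C h).ennreal_ofReal.pow_const _), lintegral_gFun_rpow hd hp hh hm]

lemma eLpNorm_gFun_comp_gauge (hK : IsSymmBody K) (hC : IsOpen (C : Set (E d))) (hd : 1 ≤ d)
    (hp : (d : ℝ≥0∞) < p) {h : ℝ} (hh : 0 < h) (hm : 0 < volume.real (K ∩ (C : Set (E d)))) :
    eLpNorm (fun x => gFun K C h (gauge K x)) (ENNReal.ofReal (conj p))
        (volume.restrict (h • K ∩ (C : Set (E d))))
      = ENNReal.ofReal (constA d p * volume.real (K ∩ (C : Set (E d))) ^ (-recip p)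
          * h ^ (1 - d * recip p)) := by
  have hq0 := conj_pos hd hp
  have hA := constA_pos hd hp
  rw [eLpNorm_eq_lintegral_rpow_enorm_toReal (by simpa using hq0) ENNReal.ofReal_ne_top,
    ENNReal.toReal_ofReal hq0.le]
  have hae : ∀ᵐ x ∂volume.restrict (h • K ∩ (C : Set (E d))),
      ‖gFun K C h (gauge K x)‖ₑ ^ conj p = ENNReal.ofReal (gFun K C h (gauge K x)) ^ conj p := by
    filter_upwards [ae_restrict_mem (hK.isOpen_smul_inter hC hh).measurableSet,
      ae_restrict_of_ae (hK.ae_gauge_ne hd 0)] with x hx hx0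
    have h1 := gFun_pos hd hm ((gauge_nonneg x).lt_of_ne' hx0) ((hK.mem_smul_iff hh).1 hx.1)
    rw [Real.enorm_eq_ofReal h1.le]
  rw [lintegral_congr_ae hae, lintegral_gFun_comp_gauge hK hd hp hh hm,
    ENNReal.ofReal_rpow_of_nonneg (by positivity) (by positivity), ← Real.rpow_mul (by positivity),
    mul_one_div_cancel hq0.ne', Real.rpow_one]

/-! ### Averaging over rays -/

lemma lintegral_comp_smul (f : E d → ℝ≥0∞) (hf : Measurable f) {t : ℝ} (ht : 0 < t) :
    ∫⁻ x, f (t • x) = ENNReal.ofReal ((t ^ d)⁻¹) * ∫⁻ x, f x := by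
  have h1 := Measure.map_addHaar_smul (volume : Measure (E d)) ht.ne'
  rw [finrank_euclideanSpace_fin, abs_of_nonneg (by positivity)] at h1
  rw [← lintegral_map hf (by fun_prop : Measurable fun x : E d => t • x), h1,
    lintegral_smul_measure, smul_eq_mul]

lemma lintegral_ray_kernel (hd : 1 ≤ d) {h u : ℝ} (hh : 0 < h) (hu : 0 < u) (huh : u < h)
    (hm : 0 < volume.real (K ∩ (C : Set (E d)))) :
    ∫⁻ t in Ioo (u / h) 1, ENNReal.ofReal (u * (t ^ (d + 1))⁻¹)
      = ENNReal.ofReal (h ^ d * volume.real (K ∩ (C : Set (E d))) * gFun K C h u) := by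
  have hd0 : (0 : ℝ) < d := by exact_mod_cast hd
  have hw : 0 < u / h := by positivity
  have hw1 : u / h < 1 := (div_lt_one hh).2 huh
  have hcont : ContinuousOn (fun t : ℝ => u * (t ^ (d + 1))⁻¹) (Icc (u / h) 1) := by
    refine continuousOn_const.mul ((continuousOn_pow _).inv₀ fun t ht => ?_)
    have := hw.trans_le ht.1
    positivity
  rw [← ofReal_integral_eq_lintegral_ofReal (hcont.integrableOn_Icc.mono_set Ioo_subset_Icc_self),
    ← integral_Ioc_eq_integral_Ioo, ← intervalIntegral.integral_of_le hw1.le,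
    intervalIntegral.integral_const_mul]
  · have h1 : ∀ t : ℝ, (t ^ (d + 1))⁻¹ = t ^ (-((d : ℤ) + 1)) := fun t => by
      rw [zpow_neg]; norm_cast
    simp_rw [h1]
    rw [integral_zpow (Or.inr ⟨by omega, by
      rw [uIcc_of_le hw1.le]; intro h0; linarith [h0.1]⟩)]
    congr 1
    rw [gFun_eq hd rfl hh hu]
    have h2 : (u / h) ^ (-((d : ℤ) + 1) + 1) = ((u / h) ^ d)⁻¹ := by
      rw [show -((d : ℤ) + 1) + 1 = -(d : ℤ) by ring, zpow_neg, zpow_natCast]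
    rw [h2, one_zpow]
    push_cast
    have h3 : (u / h) ^ d = u * u ^ (d - 1) / h ^ d := by
      rw [div_pow, ← pow_succ', Nat.sub_add_cancel hd]
    rw [h3]
    have h4 : (-((d : ℝ) + 1) + 1) = -d := by ring
    rw [h4]
    field_simp
    ring
  · filter_upwards [ae_restrict_mem measurableSet_Ioo] with t ht
    have := hw.trans ht.1
    simp only [Pi.zero_apply]
    positivity

/-- Averaging the ray integrals `∫₀¹ Φ(t y) |y|_K dt` over `y ∈ hK ∩ C` produces the kernel `g_h`,
by the substitution `z = t y` and integration in `t` for fixed `z`. -/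
lemma lintegral_ray_le (hK : IsSymmBody K) (hC : IsOpen (C : Set (E d))) (hd : 1 ≤ d) {h : ℝ}
    (hh : 0 < h) (hm : 0 < volume.real (K ∩ (C : Set (E d)))) {Φ : E d → ℝ≥0∞} (hΦ : Measurable Φ) :
    ∫⁻ y in h • K ∩ (C : Set (E d)), ∫⁻ t in Ioo (0 : ℝ) 1, Φ (t • y) * ENNReal.ofReal (gauge K y)
      ≤ volume (h • K ∩ (C : Set (E d))) * ∫⁻ z in h • K ∩ (C : Set (E d)),
          Φ z * ENNReal.ofReal (gFun K C h (gauge K z)) := by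
  have hg := hK.continuous_gauge.measurable
  have hD := (hK.isOpen_smul_inter hC hh).measurableSet
  -- the integrand after the substitution `z = t y`
  let Ψ : ℝ → E d → ℝ≥0∞ := fun t z => (C : Set (E d)).indicator Φ z *
    {q : ℝ × E d | gauge K q.2 < q.1 * h}.indicator
      (fun q => ENNReal.ofReal (gauge K q.2 * (q.1 ^ (d + 1))⁻¹)) (t, z)
  have hΨ : Measurable (Function.uncurry Ψ) := by
    refine ((hΦ.indicator hC.measurableSet).comp measurable_snd).mul
      (Measurable.indicator ?_ (measurableSet_lt (hg.comp measurable_snd) (by fun_prop)))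
    exact ((hg.comp measurable_snd).mul (by fun_prop)).ennreal_ofReal
  have step1 : ∀ t ∈ Ioo (0 : ℝ) 1,
      ∫⁻ y in h • K ∩ (C : Set (E d)), Φ (t • y) * ENNReal.ofReal (gauge K y) = ∫⁻ z, Ψ t z := by
    intro t ht
    have htd : 0 < t ^ d := pow_pos ht.1 d
    have h1 : ∀ y, (h • K ∩ (C : Set (E d))).indicator
        (fun y => Φ (t • y) * ENNReal.ofReal (gauge K y)) y
          = ENNReal.ofReal (t ^ d) * Ψ t (t • y) := by
      intro y
      have hmemC : t • y ∈ (C : Set (E d)) ↔ y ∈ (C : Set (E d)) := by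
        refine ⟨fun hy => ?_, fun hy => C.smul_mem ht.1 hy⟩
        have := C.smul_mem (inv_pos.2 ht.1) hy
        rwa [inv_smul_smul₀ ht.1.ne'] at this
      have hgt : gauge K (t • y) = t * gauge K y := by
        rw [gauge_smul_of_nonneg ht.1.le, smul_eq_mul]
      have hmemK : (t, t • y) ∈ {q : ℝ × E d | gauge K q.2 < q.1 * h} ↔ y ∈ h • K := by
        rw [hK.mem_smul_iff hh, mem_ofPred_eq, hgt, mul_lt_mul_iff_right₀ ht.1]
      simp only [Ψ]
      by_cases hyD : y ∈ h • K ∩ (C : Set (E d))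
      · have e : gauge K y = t ^ d * (t * gauge K y * (t ^ (d + 1))⁻¹) := by
          have := ht.1
          field_simp
          ring
        rw [indicator_of_mem hyD, indicator_of_mem (hmemC.2 hyD.2),
          indicator_of_mem (hmemK.2 hyD.1), hgt, mul_left_comm, ← ENNReal.ofReal_mul htd.le, ← e]
      · rw [indicator_of_notMem hyD]
        by_cases hyC : y ∈ (C : Set (E d))
        · rw [indicator_of_notMem (fun hc => hyD ⟨hmemK.1 hc, hyC⟩)]; simp
        · rw [indicator_of_notMem (fun hc => hyC (hmemC.1 hc))]; simp
    rw [← lintegral_indicator hD, lintegral_congr h1,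
      lintegral_const_mul' _ _ ENNReal.ofReal_ne_top,
      lintegral_comp_smul (Ψ t) (hΨ.comp measurable_prodMk_left) ht.1, ← mul_assoc,
      ← ENNReal.ofReal_mul htd.le, mul_inv_cancel₀ htd.ne', ENNReal.ofReal_one, one_mul]
  have step2 : ∀ᵐ z, ∫⁻ t in Ioo (0 : ℝ) 1, Ψ t z ≤ (h • K ∩ (C : Set (E d))).indicator (fun z =>
      volume (h • K ∩ (C : Set (E d))) * (Φ z * ENNReal.ofReal (gFun K C h (gauge K z)))) z := by
    filter_upwards [hK.ae_gauge_ne hd 0] with z hz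
    have hu : 0 < gauge K z := (gauge_nonneg z).lt_of_ne' hz
    by_cases hzD : z ∈ h • K ∩ (C : Set (E d))
    · have huh := (hK.mem_smul_iff hh).1 hzD.1
      rw [indicator_of_mem hzD, hK.volume_smul_inter hd hh, mul_left_comm, ← ENNReal.ofReal_mul
        (by positivity), ← lintegral_ray_kernel hd hh hu huh hm]
      simp only [Ψ, indicator_of_mem hzD.2]
      rw [lintegral_const_mul]
      · refine mul_le_mul' le_rfl ?_
        have hset : Ioo (gauge K z / h) 1 = {t | gauge K z < t * h} ∩ Ioo 0 1 := by
          ext t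
          simp only [mem_Ioo, mem_inter_iff, mem_ofPred_eq, div_lt_iff₀ hh]
          refine ⟨fun ht => ⟨ht.1, ?_, ht.2⟩, fun ht => ⟨ht.1, ht.2.2⟩⟩
          exact pos_of_mul_pos_left (hu.trans ht.1) hh.le
        have hset' : MeasurableSet {t : ℝ | gauge K z < t * h} :=
          measurableSet_lt measurable_const (by fun_prop)
        rw [hset, ← Measure.restrict_restrict hset', ← lintegral_indicator hset']
        exact le_of_eq (lintegral_congr fun t => rfl)
      · refine (Measurable.indicator ?_ ?_).comp (by fun_prop : Measurable fun t : ℝ => (t, z))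
        · exact ((hg.comp measurable_snd).mul (by fun_prop)).ennreal_ofReal
        · exact measurableSet_lt (hg.comp measurable_snd) (by fun_prop)
    · rw [indicator_of_notMem hzD, nonpos_iff_eq_zero]
      refine setLIntegral_eq_zero measurableSet_Ioo fun t ht => ?_
      by_cases hzC : z ∈ (C : Set (E d))
      · have : ¬ gauge K z < t * h := by
          intro hlt
          refine hzD ⟨(hK.mem_smul_iff hh).2 (hlt.trans ?_), hzC⟩
          nlinarith [ht.2]
        simp [Ψ, indicator, this]
      · simp [Ψ, hzC]
  have hmeas : Measurable fun q : E d × ℝ => Φ (q.2 • q.1) * ENNReal.ofReal (gauge K q.1) :=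
    (hΦ.comp (by fun_prop)).mul (hg.comp measurable_fst).ennreal_ofReal
  rw [lintegral_lintegral_swap hmeas.aemeasurable,
    setLIntegral_congr_fun measurableSet_Ioo step1, lintegral_lintegral_swap hΨ.aemeasurable]
  refine (lintegral_mono_ae step2).trans (le_of_eq ?_)
  rw [lintegral_indicator hD, lintegral_const_mul]
  exact hΦ.mul ((measurable_gFun K C h).comp hg).ennreal_ofReal

/-! ### The additive inequality -/

lemma vadd_smul_inter_subset {x : E d} (hx : x ∈ C) (h : ℝ) :
    x +ᵥ (h • K ∩ (C : Set (E d))) ⊆ C := by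
  rintro _ ⟨y, hy, rfl⟩
  exact C.add_mem hx hy.2

/-- A finite value of the charge excludes an infinite integral of the positive or of the negative
part: in `EReal`, `⊤ - ⊤ = ⊥` has infinite absolute value as well. -/
lemma Charge.IsRNDeriv.integrableOn_and_enorm_eq {ν : Charge (C : Set (E d))} {f : E d → ℝ}
    (hν : ν.IsRNDeriv f) {A : Set (E d)} (hA : NullMeasurableSet A volume)
    (hAC : A ⊆ C) (hfin : (ν.val A).abs < ⊤) :
    IntegrableOn f A ∧ ‖∫ x in A, f x‖ₑ = (ν.val A).abs := by
  have hm : AEMeasurable f (volume.restrict A) := hν.1.mono_set hAC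
  have hval := hν.2 A hA hAC
  have htop : ν.val A ≠ ⊤ := by rintro h; simp [h] at hfin
  have hbot : ν.val A ≠ ⊥ := by rintro h; simp [h] at hfin
  obtain ⟨P, hP⟩ : ∃ P, P = ∫⁻ x in A, ENNReal.ofReal (f x) := ⟨_, rfl⟩
  obtain ⟨M, hM⟩ : ∃ M, M = ∫⁻ x in A, ENNReal.ofReal (-f x) := ⟨_, rfl⟩
  rw [← hP, ← hM] at hval
  have hMt : M ≠ ⊤ := by
    rintro h; rw [h] at hval; simp at hval; exact hbot hval
  have hPt : P ≠ ⊤ := by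
    rintro h
    rw [h] at hval
    lift M to NNReal using hMt
    exact htop (hval.trans (by rfl))
  have hint : IntegrableOn f A := by
    refine ⟨hm.aestronglyMeasurable, ?_⟩
    have hle : ∀ x, ‖f x‖ₑ = ENNReal.ofReal (f x) + ENNReal.ofReal (-f x) := by
      intro x
      rw [Real.enorm_eq_ofReal_abs]
      rcases le_total 0 (f x) with h | h
      · rw [abs_of_nonneg h, ENNReal.ofReal_of_nonpos (neg_nonpos.2 h), add_zero]
      · rw [abs_of_nonpos h, ENNReal.ofReal_of_nonpos h, zero_add]
    rw [hasFiniteIntegral_iff_enorm, lintegral_congr hle,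
      lintegral_add_left' hm.ennreal_ofReal]
    exact ENNReal.add_lt_top.2 ⟨hP ▸ hPt.lt_top, hM ▸ hMt.lt_top⟩
  refine ⟨hint, ?_⟩
  rw [hval, integral_eq_lintegral_pos_part_sub_lintegral_neg_part hint, ← hP, ← hM]
  lift P to NNReal using hPt
  lift M to NNReal using hMt
  rw [show ((P : ℝ≥0∞) : EReal) - ((M : ℝ≥0∞) : EReal) = (((P : ℝ) - (M : ℝ) : ℝ) : EReal) from rfl,
    EReal.abs_def, Real.enorm_eq_ofReal_abs]
  rfl

/-- The mean of `f` over `x + (hK ∩ C)` differs from `f x` by at most the convolution of the dual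
norm of the gradient with `g_h`. -/
lemma IsWeakGradient.ae_enorm_mul_le (hK : IsSymmBody K) (hC : IsOpen (C : Set (E d))) (hd : 1 ≤ d)
    (hm : 0 < volume.real (K ∩ (C : Set (E d)))) {f : E d → ℝ} {G : E d → E d}
    (hfG : IsWeakGradient C f G) (hf : Measurable f) (hG : Measurable G) {h : ℝ} (hh : 0 < h) :
    ∀ᵐ x ∂volume.restrict (C : Set (E d)),
      IntegrableOn (fun y => f (x + y)) (h • K ∩ (C : Set (E d))) →
      ‖f x‖ₑ * volume (h • K ∩ (C : Set (E d))) ≤ ‖∫ y in h • K ∩ (C : Set (E d)), f (x + y)‖ₑ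
        + volume (h • K ∩ (C : Set (E d))) * ∫⁻ z in h • K ∩ (C : Set (E d)),
          ENNReal.ofReal (dualNorm K (G (x + z))) * ENNReal.ofReal (gFun K C h (gauge K z)) := by
  filter_upwards [hfG.ae_enorm_sub_le hK hC hf hG] with x hx hint
  set D := h • K ∩ (C : Set (E d)) with hD
  have hDt : volume D ≠ ⊤ := by
    rw [hD, hK.volume_smul_inter hd hh]; exact ENNReal.ofReal_ne_top
  have hconst : IntegrableOn (fun _ => f x) D := integrableOn_const hDt
  have hx' : ∀ᵐ y ∂volume.restrict D, ‖f (x + y) - f x‖ₑ ≤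
        ∫⁻ t in Ioo (0 : ℝ) 1, ENNReal.ofReal (dualNorm K (G (x + t • y))) *
          ENNReal.ofReal (gauge K y) := by
    refine (ae_restrict_of_ae_restrict_of_subset inter_subset_right hx).mono fun y hy => ?_
    refine hy.trans (le_of_eq (lintegral_congr fun t => ?_))
    rw [ENNReal.ofReal_mul (hK.dualNorm_nonneg _)]
  have e1 : ‖f x‖ₑ * volume D = ‖∫ y in D, f x‖ₑ := by
    rw [setIntegral_const, smul_eq_mul, enorm_mul, mul_comm, Measure.real,
      Real.enorm_eq_ofReal ENNReal.toReal_nonneg, ENNReal.ofReal_toReal hDt]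
  have e2 : ∫ y in D, f x = (∫ y in D, f (x + y)) - ∫ y in D, (f (x + y) - f x) := by
    rw [integral_sub hint hconst]; ring
  rw [e1, e2]
  refine (enorm_sub_le).trans (add_le_add le_rfl ?_)
  refine (enorm_integral_le_lintegral_enorm _).trans ((lintegral_mono_ae hx').trans ?_)
  refine lintegral_ray_le hK hC hd hh hm (Φ := fun z => ENNReal.ofReal (dualNorm K (G (x + z)))) ?_
  exact (hK.continuous_dualNorm.measurable.comp (hG.comp (by fun_prop))).ennreal_ofReal

/-- Hölder's inequality for the convolution with the kernel `g_h`. -/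
lemma lintegral_dualNorm_mul_gFun_le (hK : IsSymmBody K) (hC : IsOpen (C : Set (E d))) (hd : 1 ≤ d)
    (hp : (d : ℝ≥0∞) < p) (hm : 0 < volume.real (K ∩ (C : Set (E d)))) {G : E d → E d}
    (hG : Measurable G) {h : ℝ} (hh : 0 < h) {x : E d} (hx : x ∈ C) :
    ∫⁻ z in h • K ∩ (C : Set (E d)),
        ENNReal.ofReal (dualNorm K (G (x + z))) * ENNReal.ofReal (gFun K C h (gauge K z))
      ≤ ENNReal.ofReal (constA d p * volume.real (K ∩ (C : Set (E d))) ^ (-recip p)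
          * h ^ (1 - d * recip p)) * gradNorm K C p G := by
  set D := h • K ∩ (C : Set (E d)) with hD
  have hDm : MeasurableSet D := (hK.isOpen_smul_inter hC hh).measurableSet
  have hN : Measurable fun z => dualNorm K (G z) := hK.continuous_dualNorm.measurable.comp hG
  have hgm : Measurable fun z => gFun K C h (gauge K z) :=
    (measurable_gFun K C h).comp hK.continuous_gauge.measurable
  have := holderConjugate_ofReal_conj hd hp
  have hmp : MeasurePreserving (fun z => x + z) (volume.restrict D)
      (volume.restrict (x +ᵥ D)) := by
    have := (measurePreserving_add_left volume x).restrict_preimage_emb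
      (MeasurableEquiv.addLeft x).measurableEmbedding (x +ᵥ D)
    rwa [show (fun z => x + z) ⁻¹' (x +ᵥ D) = D from
      preimage_image_eq _ (add_right_injective x)] at this
  have htrans : eLpNorm (fun z => dualNorm K (G (x + z))) p (volume.restrict D)
      ≤ gradNorm K C p G := by
    rw [gradNorm, ← Function.comp_def (fun z => dualNorm K (G z)) (fun z => x + z),
      eLpNorm_comp_measurePreserving hN.aestronglyMeasurable hmp]
    exact eLpNorm_mono_measure _ (Measure.restrict_mono_set _ (vadd_smul_inter_subset hx h))
  have hhol := eLpNorm_smul_le_mul_eLpNorm (p := p) (q := ENNReal.ofReal (conj p)) (r := 1)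
    (μ := volume.restrict D) (f := fun z => gFun K C h (gauge K z)) hgm.aestronglyMeasurable
    (φ := fun z => dualNorm K (G (x + z))) (hN.comp (measurable_const_add x)).aestronglyMeasurable
  rw [eLpNorm_gFun_comp_gauge hK hC hd hp hh hm, mul_comm] at hhol
  refine le_trans ?_ (hhol.trans (mul_le_mul' le_rfl htrans))
  rw [eLpNorm_one_eq_lintegral_enorm]
  refine lintegral_mono fun z => ?_
  rw [Pi.smul_apply', smul_eq_mul, enorm_mul]
  exact mul_le_mul' (Real.ofReal_le_enorm _) (Real.ofReal_le_enorm _)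

lemma supNorm_congr {U : Set (E d)} {f f' : E d → ℝ} (h : f =ᵐ[volume.restrict U] f') :
    supNorm U f = supNorm U f' := eLpNorm_congr_ae h

lemma gradNorm_congr {U : Set (E d)} {G G' : E d → E d} (h : G =ᵐ[volume.restrict U] G') :
    gradNorm K U p G = gradNorm K U p G' :=
  eLpNorm_congr_ae (h.mono fun x hx => by simp only [hx])

theorem supNorm_le_additiveBound (hK : IsSymmBody K) (hC : IsOpen (C : Set (E d)))
    (hCn : (C : Set (E d)).Nonempty) (hd : 1 ≤ d) (hp : (d : ℝ≥0∞) < p) {h : ℝ} (hh : 0 < h)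
    {ν : Charge (C : Set (E d))} (hS : ν.seminormAt K h < ⊤) {f : E d → ℝ} (hν : ν.IsRNDeriv f)
    {G : E d → E d} (hfG : IsWeakGradient C f G) :
    supNorm C f ≤ additiveBound p K C h (gradNorm K C p G) (ν.seminormAt K h) := by
  have hm := hK.volumeReal_inter_pos hC hCn
  have hDm : MeasurableSet (h • K ∩ (C : Set (E d))) := (hK.isOpen_smul_inter hC hh).measurableSet
  obtain ⟨f₀, hf₀, hff₀⟩ := hν.1
  obtain ⟨G₀, hG₀, hGG₀⟩ := hfG.2.1.aestronglyMeasurable.aemeasurable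
  rw [supNorm_congr hff₀, gradNorm_congr hGG₀, supNorm, eLpNorm_exponent_top]
  refine essSup_le_of_ae_le _ ?_
  filter_upwards [(hfG.congr hC hff₀ hGG₀).ae_enorm_mul_le hK hC hd hm hf₀ hG₀ hh,
    ae_restrict_mem hC.measurableSet] with x hx hxC
  set D := h • K ∩ (C : Set (E d)) with hD
  have hDn : volume D = ENNReal.ofReal (h ^ d * volume.real (K ∩ (C : Set (E d)))) :=
    hK.volume_smul_inter hd hh
  have hsub : x +ᵥ D ⊆ C := vadd_smul_inter_subset hxC h
  have hle : (ν.val (x +ᵥ D)).abs ≤ ν.seminormAt K h :=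
    le_iSup₂_of_le (f := fun x (_ : x ∈ (C : Set (E d))) =>
      (ν.val (x +ᵥ (h • K ∩ (C : Set (E d))))).abs) x hxC le_rfl
  obtain ⟨hi, he⟩ := hν.integrableOn_and_enorm_eq (hDm.const_vadd x).nullMeasurableSet hsub
    (hle.trans_lt hS)
  have hff' : f =ᵐ[volume.restrict (x +ᵥ D)] f₀ :=
    ae_restrict_of_ae_restrict_of_subset hsub hff₀
  have hpre : (fun z => x + z) ⁻¹' (x +ᵥ D) = D := preimage_image_eq _ (add_right_injective x)
  have hmp := measurePreserving_add_left (volume : Measure (E d)) x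
  have hemb := (MeasurableEquiv.addLeft x).measurableEmbedding
  have hi' : IntegrableOn (fun y => f₀ (x + y)) D := by
    have := (hmp.integrableOn_comp_preimage hemb (f := f₀) (s := x +ᵥ D)).2
      (hi.congr_fun_ae hff')
    rwa [hpre] at this
  have he' : ∫ y in D, f₀ (x + y) = ∫ y in x +ᵥ D, f y := by
    rw [integral_congr_ae hff', ← hmp.setIntegral_preimage_emb hemb f₀ (x +ᵥ D), hpre]
  have hmain := hx hi'
  rw [he', he] at hmain
  have hD0 : volume D ≠ 0 := by rw [hDn]; simp; positivity
  have hDt : volume D ≠ ⊤ := by rw [hDn]; exact ENNReal.ofReal_ne_top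
  have hinv :
      ENNReal.ofReal ((volume.real (K ∩ (C : Set (E d))))⁻¹ * (h ^ d)⁻¹) = (volume D)⁻¹ := by
    rw [hDn, ← ENNReal.ofReal_inv_of_pos (by positivity), mul_inv_rev]
  calc ‖f₀ x‖ₑ = (‖f₀ x‖ₑ * volume D) * (volume D)⁻¹ := by
        rw [mul_assoc, ENNReal.mul_inv_cancel hD0 hDt, mul_one]
    _ ≤ (ν.seminormAt K h + volume D * (ENNReal.ofReal (constA d p *
          volume.real (K ∩ (C : Set (E d))) ^ (-recip p) * h ^ (1 - d * recip p))
            * gradNorm K C p G₀)) * (volume D)⁻¹ := by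
        refine mul_le_mul' (hmain.trans (add_le_add hle (mul_le_mul' le_rfl ?_))) le_rfl
        exact lintegral_dualNorm_mul_gFun_le hK hC hd hp hm hG₀ hh hxC
    _ = additiveBound p K C h (gradNorm K C p G₀) (ν.seminormAt K h) := by
        rw [additiveBound, hinv, add_mul, mul_comm (volume D), mul_assoc _ (volume D),
          ENNReal.mul_inv_cancel hD0 hDt, mul_one, add_comm, mul_comm (ν.seminormAt K h)]

/-! ### The multiplicative inequality -/

lemma expAlpha_eq (hd : 1 ≤ d) : expAlpha d p = (1 + (1 / (d : ℝ) - recip p))⁻¹ := by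
  have hd0 : (0 : ℝ) < d := by exact_mod_cast hd
  rw [expAlpha, ← inv_div]
  congr 1
  field_simp
  ring

/-- The weighted geometric mean that connects the two bounds: with weights `α` and `1 - α` the
powers of `h` in the two summands of the additive bound cancel. -/
lemma multiplicative_eq_geom_mean (hd : 1 ≤ d) (hp : (d : ℝ≥0∞) < p) {m h N S : ℝ} (hm : 0 < m)
    (hh : 0 < h) (hN : 0 ≤ N) (hS : 0 ≤ S) :
    constSmallA d p * m ^ (-(expAlpha d p / d)) * S ^ (1 - expAlpha d p) * N ^ expAlpha d p
      = (constA d p * m ^ (-recip p) * h ^ (1 - d * recip p) * N / expAlpha d p) ^ expAlpha d p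
        * (m⁻¹ * (h ^ d)⁻¹ * S / (1 - expAlpha d p)) ^ (1 - expAlpha d p) := by
  have hd0 : (0 : ℝ) < d := by exact_mod_cast hd
  have hA := constA_pos hd hp
  set r := recip p with hr
  set δ := 1 / (d : ℝ) - r with hδ
  have hδ0 : 0 < δ := by have := recip_lt hd hp; rw [hδ]; linarith
  have hα : expAlpha d p = (1 + δ)⁻¹ := expAlpha_eq hd
  set α := expAlpha d p with hαdef
  have hα0 : 0 < α := by rw [hα]; positivity
  have h1α : 1 - α = α * δ := by rw [hα]; field_simp; ring
  have h1α0 : 0 < 1 - α := by rw [h1α]; positivity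
  rw [constSmallA, ← hαdef, ← hr, ← hδ]
  have eX : (constA d p * m ^ (-r) * h ^ (1 - d * r) * N / α) ^ α
      = constA d p ^ α * m ^ (-r * α) * h ^ ((1 - d * r) * α) * N ^ α * α ^ (-α) := by
    rw [Real.div_rpow (by positivity) hα0.le, Real.mul_rpow (by positivity) hN,
      Real.mul_rpow (by positivity) (by positivity), Real.mul_rpow (by positivity) (by positivity),
      ← Real.rpow_mul hm.le, ← Real.rpow_mul hh.le, Real.rpow_neg hα0.le, div_eq_mul_inv]
  have eY : (m⁻¹ * (h ^ d)⁻¹ * S / (1 - α)) ^ (1 - α)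
      = m ^ (-(1 - α)) * h ^ (-(d * (1 - α))) * S ^ (1 - α) * (1 - α) ^ (-(1 - α)) := by
    rw [Real.div_rpow (by positivity) h1α0.le, Real.mul_rpow (by positivity) hS,
      Real.mul_rpow (by positivity) (by positivity), Real.inv_rpow hm.le,
      Real.inv_rpow (by positivity), ← Real.rpow_natCast, ← Real.rpow_mul hh.le,
      Real.rpow_neg hm.le, Real.rpow_neg hh.le, Real.rpow_neg h1α0.le, div_eq_mul_inv]
  have eh : h ^ ((1 - d * r) * α) * h ^ (-(d * (1 - α))) = 1 := by
    rw [← Real.rpow_add hh, h1α, hδ]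
    rw [show (1 - d * r) * α + -(d * (α * (1 / d - r))) = 0 by field_simp; ring, Real.rpow_zero]
  have em : m ^ (-r * α) * m ^ (-(1 - α)) = m ^ (-(α / d)) := by
    rw [← Real.rpow_add hm, h1α, hδ]
    congr 1
    field_simp
    ring
  have eα : α ^ (-α) * (1 - α) ^ (-(1 - α)) = δ ^ α * (1 / δ + 1) := by
    have hαinv : 1 / δ + 1 = α⁻¹ * δ⁻¹ := by rw [hα, inv_inv]; field_simp
    rw [hαinv]
    have e : (1 - α) ^ (-(1 - α)) = (α * δ) ^ (-(1 - α)) :=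
      congrArg (fun z => z ^ (-(1 - α))) h1α
    rw [e, Real.mul_rpow hα0.le hδ0.le, ← mul_assoc, ← Real.rpow_add hα0,
      show -α + -(1 - α) = -1 by ring, Real.rpow_neg_one, neg_sub, Real.rpow_sub hδ0, Real.rpow_one]
    ring
  rw [eX, eY, Real.mul_rpow hδ0.le hA.le]
  calc _ = (δ ^ α * (1 / δ + 1)) * constA d p ^ α * m ^ (-(α / d)) * S ^ (1 - α) * N ^ α := by ring
    _ = (α ^ (-α) * (1 - α) ^ (-(1 - α))) * constA d p ^ α * (m ^ (-r * α) * m ^ (-(1 - α)))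
        * S ^ (1 - α) * N ^ α * (h ^ ((1 - d * r) * α) * h ^ (-(d * (1 - α)))) := by
        rw [eα, em, eh, mul_one]
    _ = _ := by ring

lemma expAlpha_mem_Ioo (hd : 1 ≤ d) (hp : (d : ℝ≥0∞) < p) : expAlpha d p ∈ Ioo (0 : ℝ) 1 := by
  have := recip_lt hd hp
  rw [expAlpha_eq hd]
  exact ⟨by positivity, inv_lt_one_of_one_lt₀ (by linarith)⟩

lemma constSmallA_nonneg (hd : 1 ≤ d) (hp : (d : ℝ≥0∞) < p) : 0 ≤ constSmallA d p := by
  have h1 : 0 < 1 / (d : ℝ) - recip p := by have := recip_lt hd hp; linarith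
  have := constA_pos hd hp
  rw [constSmallA]
  positivity

lemma additiveBound_eq_ofReal (hd : 1 ≤ d) (hp : (d : ℝ≥0∞) < p) (K C : Set (E d)) {h : ℝ}
    (hh : 0 < h) {N S : ℝ≥0∞} (hN : N ≠ ⊤) (hS : S ≠ ⊤) :
    additiveBound p K C h N S = ENNReal.ofReal
      (constA d p * volume.real (K ∩ C) ^ (-recip p) * h ^ (1 - d * recip p) * N.toReal
        + (volume.real (K ∩ C))⁻¹ * (h ^ d)⁻¹ * S.toReal) := by
  have hA := constA_pos hd hp
  have hm : 0 ≤ volume.real (K ∩ C) := measureReal_nonneg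
  rw [additiveBound, ENNReal.ofReal_add (by positivity) (by positivity),
    ENNReal.ofReal_mul (q := N.toReal) (by positivity), ENNReal.ofReal_mul (q := S.toReal)
    (by positivity), ENNReal.ofReal_toReal hN, ENNReal.ofReal_toReal hS]

lemma multiplicativeBound_eq_ofReal (hd : 1 ≤ d) (hp : (d : ℝ≥0∞) < p) (K C : Set (E d))
    {N S : ℝ≥0∞} (hN : N ≠ ⊤) (hS : S ≠ ⊤) :
    multiplicativeBound p K C N S = ENNReal.ofReal
      (constSmallA d p * volume.real (K ∩ C) ^ (-(expAlpha d p / d))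
        * S.toReal ^ (1 - expAlpha d p) * N.toReal ^ expAlpha d p) := by
  have ha := constSmallA_nonneg hd hp
  have hα := expAlpha_mem_Ioo hd hp
  have hm : 0 ≤ volume.real (K ∩ C) := measureReal_nonneg
  have h1 : 0 ≤ 1 - expAlpha d p := by linarith [hα.2]
  rw [multiplicativeBound, ENNReal.ofReal_mul (q := N.toReal ^ _) (by positivity),
    ENNReal.ofReal_mul (q := S.toReal ^ _) (by positivity),
    ← ENNReal.ofReal_rpow_of_nonneg ENNReal.toReal_nonneg h1,
    ← ENNReal.ofReal_rpow_of_nonneg ENNReal.toReal_nonneg hα.1.le, ENNReal.ofReal_toReal hN,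
    ENNReal.ofReal_toReal hS]

lemma multiplicativeBound_le_additiveBound (hd : 1 ≤ d) (hp : (d : ℝ≥0∞) < p) {K C : Set (E d)}
    (hm : 0 < volume.real (K ∩ C)) {h : ℝ} (hh : 0 < h) {N S : ℝ≥0∞} (hN : N ≠ ⊤) (hS : S ≠ ⊤) :
    multiplicativeBound p K C N S ≤ additiveBound p K C h N S := by
  have hA := constA_pos hd hp
  have hα := expAlpha_mem_Ioo hd hp
  have hα0 := hα.1
  have h1 : 0 < 1 - expAlpha d p := by linarith [hα.2]
  rw [additiveBound_eq_ofReal hd hp K C hh hN hS, multiplicativeBound_eq_ofReal hd hp K C hN hS,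
    multiplicative_eq_geom_mean hd hp hm hh ENNReal.toReal_nonneg ENNReal.toReal_nonneg]
  refine ENNReal.ofReal_le_ofReal ((Real.geom_mean_le_arith_mean2_weighted hα0.le h1.le
    (by positivity) (by positivity) (by ring)).trans (le_of_eq ?_))
  field_simp

/-- Minimizing the additive bound over `h`: for positive `N` and `S` the two terms of the weighted
arithmetic mean agree at one `h`. -/
lemma exists_additive_eq_multiplicative (hd : 1 ≤ d) (hp : (d : ℝ≥0∞) < p) {m N S : ℝ} (hm : 0 < m)
    (hN : 0 < N) (hS : 0 < S) :
    ∃ h : ℝ, 0 < h ∧ constA d p * m ^ (-recip p) * h ^ (1 - d * recip p) * N + m⁻¹ * (h ^ d)⁻¹ * S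
      = constSmallA d p * m ^ (-(expAlpha d p / d)) * S ^ (1 - expAlpha d p)
        * N ^ expAlpha d p := by
  have hA := constA_pos hd hp
  have hd0 : (0 : ℝ) < d := by exact_mod_cast hd
  obtain ⟨hα0, hα1⟩ := expAlpha_mem_Ioo hd hp
  set α := expAlpha d p with hα
  have h1 : 0 < 1 - α := by linarith
  have hβ := mul_recip_lt_one hd hp
  set c := constA d p * m ^ (-recip p) with hc
  have hc0 : 0 < c := by positivity
  set e : ℝ := 1 - d * recip p + d with he
  have he0 : 0 < e := by rw [he]; linarith
  set w : ℝ := (α * m⁻¹ * S) / ((1 - α) * c * N) with hw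
  have hw0 : 0 < w := by positivity
  set h : ℝ := w ^ (1 / e) with hh
  have hh0 : 0 < h := by positivity
  refine ⟨h, hh0, ?_⟩
  rw [multiplicative_eq_geom_mean hd hp hm hh0 hN.le hS.le, ← hα, ← hc]
  have hpow : h ^ (1 - d * recip p) * h ^ d = w := by
    rw [← Real.rpow_natCast h d, ← Real.rpow_add hh0, ← he, hh, ← Real.rpow_mul hw0.le,
      one_div_mul_cancel he0.ne', Real.rpow_one]
  have heq : c * h ^ (1 - d * recip p) * N / α = m⁻¹ * (h ^ d)⁻¹ * S / (1 - α) := by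
    have h2 : h ^ (1 - d * recip p) = w * (h ^ d)⁻¹ := by
      rw [← hpow, mul_inv_cancel_right₀ (by positivity)]
    rw [h2, hw]
    field_simp
  have hZ : 0 < m⁻¹ * (h ^ d)⁻¹ * S / (1 - α) := by positivity
  rw [heq, ← Real.rpow_add hZ, show α + (1 - α) = 1 by ring, Real.rpow_one]
  have h3 : c * h ^ (1 - d * recip p) * N = α * (m⁻¹ * (h ^ d)⁻¹ * S / (1 - α)) := by
    rw [← heq]; field_simp
  rw [h3]
  field_simp
  ring

lemma le_multiplicativeBound_of_forall_le (hd : 1 ≤ d) (hp : (d : ℝ≥0∞) < p) {K C : Set (E d)}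
    (hm : 0 < volume.real (K ∩ C)) {N S X : ℝ≥0∞} (hN : N ≠ ⊤) (hS : S ≠ ⊤)
    (hX : ∀ h : ℝ, 0 < h → X ≤ additiveBound p K C h N S) :
    X ≤ multiplicativeBound p K C N S := by
  have hA := constA_pos hd hp
  obtain ⟨hα0, hα1⟩ := expAlpha_mem_Ioo hd hp
  -- `N` and `S` may vanish, so both are increased by a small `ε`
  have hε : ∀ ε : ℝ, 0 < ε → X ≤ ENNReal.ofReal
      (constSmallA d p * volume.real (K ∩ C) ^ (-(expAlpha d p / d))
        * (S.toReal + ε) ^ (1 - expAlpha d p) * (N.toReal + ε) ^ expAlpha d p) := by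
    intro ε hε
    have hN0 : 0 ≤ N.toReal := ENNReal.toReal_nonneg
    have hS0 : 0 ≤ S.toReal := ENNReal.toReal_nonneg
    obtain ⟨h, hh, hEq⟩ := exists_additive_eq_multiplicative hd hp hm
      (by linarith : 0 < N.toReal + ε) (by linarith : 0 < S.toReal + ε)
    rw [← hEq]
    refine (hX h hh).trans ?_
    rw [additiveBound_eq_ofReal hd hp K C hh hN hS]
    refine ENNReal.ofReal_le_ofReal (add_le_add ?_ ?_) <;>
    exact mul_le_mul_of_nonneg_left (by linarith) (by positivity)
  rw [multiplicativeBound_eq_ofReal hd hp K C hN hS]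
  have hlim : Tendsto (fun ε : ℝ => ENNReal.ofReal
      (constSmallA d p * volume.real (K ∩ C) ^ (-(expAlpha d p / d))
        * (S.toReal + ε) ^ (1 - expAlpha d p) * (N.toReal + ε) ^ expAlpha d p)) (𝓝[>] 0)
      (𝓝 (ENNReal.ofReal (constSmallA d p * volume.real (K ∩ C) ^ (-(expAlpha d p / d))
        * (S.toReal + 0) ^ (1 - expAlpha d p) * (N.toReal + 0) ^ expAlpha d p))) := by
    refine Tendsto.mono_left ?_ nhdsWithin_le_nhds
    refine (Continuous.tendsto (ENNReal.continuous_ofReal.comp ?_) 0)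
    refine (continuous_const.mul ?_).mul ?_
    · exact (by fun_prop : Continuous fun ε : ℝ => S.toReal + ε).rpow_const fun _ =>
        Or.inr (by linarith)
    · exact (by fun_prop : Continuous fun ε : ℝ => N.toReal + ε).rpow_const fun _ =>
        Or.inr hα0.le
  rw [add_zero, add_zero] at hlim
  exact ge_of_tendsto hlim (by filter_upwards [self_mem_nhdsWithin] with ε h using hε ε h)

lemma gradNorm_lt_top (hK : IsSymmBody K) {U : Set (E d)} {G : E d → E d}
    (hG : MemLp G p (volume.restrict U)) : gradNorm K U p G < ⊤ := by
  obtain ⟨R, hR0, hR⟩ := hK.exists_norm_le_mul_gauge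
  refine (hG.of_le_mul (c := R) (hK.continuous_dualNorm.comp_aestronglyMeasurable hG.1)
    (Eventually.of_forall fun x => ?_)).2
  rw [Real.norm_of_nonneg (hK.dualNorm_nonneg _)]
  refine dualNorm_le fun y hy => (real_inner_le_norm y _).trans ?_
  gcongr
  exact (hR y).trans (mul_le_of_le_one_right hR0.le hy)

lemma additiveBound_mono (K C : Set (E d)) (h : ℝ) {N S S' : ℝ≥0∞} (hS : S ≤ S') :
    additiveBound p K C h N S ≤ additiveBound p K C h N S' := by
  unfold additiveBound
  gcongr

lemma Charge.seminormAt_le_seminorm {U : Set (E d)} (ν : Charge U) (K : Set (E d)) {h : ℝ}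
    (hh : 0 < h) : ν.seminormAt K h ≤ ν.seminorm K :=
  le_iSup₂_of_le (f := fun h (_ : (0 : ℝ) < h) => ν.seminormAt K h) h hh le_rfl

theorem supNorm_le_multiplicativeBound (hK : IsSymmBody K) (hC : IsOpen (C : Set (E d)))
    (hCn : (C : Set (E d)).Nonempty) (hd : 1 ≤ d) (hp : (d : ℝ≥0∞) < p)
    {ν : Charge (C : Set (E d))} (hS : ν.seminorm K < ⊤) {f : E d → ℝ} (hν : ν.IsRNDeriv f)
    (hf : MemSobolev C p f) {G : E d → E d} (hfG : IsWeakGradient C f G) :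
    supNorm C f ≤ multiplicativeBound p K C (gradNorm K C p G) (ν.seminorm K) := by
  obtain ⟨G', hfG', hG'⟩ := hf
  have hN : gradNorm K C p G < ⊤ := by
    rw [gradNorm_congr (hfG.ae_eq hC hfG')]
    exact gradNorm_lt_top hK hG'
  refine le_multiplicativeBound_of_forall_le hd hp (hK.volumeReal_inter_pos hC hCn) hN.ne hS.ne
    fun h hh => ?_
  have hle := ν.seminormAt_le_seminorm K hh
  exact (supNorm_le_additiveBound hK hC hCn hd hp hh (hle.trans_lt hS) hν hfG).trans
    (additiveBound_mono _ _ _ hle)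

/-! ### Radial functions and their weak gradients -/

section Primitive

variable {w : ℝ → ℝ} {M : ℝ}

lemma intervalIntegrable_of_bound (hw : Measurable w) (hM : ∀ u, |w u| ≤ M) (a b : ℝ) :
    IntervalIntegrable w volume a b :=
  (intervalIntegrable_const (c := M)).mono_fun hw.aestronglyMeasurable
    (Eventually.of_forall fun u => (hM u).trans (le_abs_self M))

lemma lipschitzWith_primitive (hw : Measurable w) (hM : ∀ u, |w u| ≤ M) (hM0 : 0 ≤ M) :
    LipschitzWith ⟨M, hM0⟩ (fun u => ∫ v in u..h, w v) := by
  refine LipschitzWith.of_dist_le_mul fun a b => ?_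
  rw [Real.dist_eq, intervalIntegral.integral_interval_sub_interval_comm'
    (intervalIntegrable_of_bound hw hM _ _) (intervalIntegrable_of_bound hw hM _ _)
    (intervalIntegrable_of_bound hw hM _ _), intervalIntegral.integral_same, zero_sub, abs_neg,
    ← Real.norm_eq_abs, Real.dist_eq]
  exact intervalIntegral.norm_integral_le_of_norm_le_const (f := w) (C := M) fun u _ => hM u

lemma hasDerivAt_primitive (hw : Measurable w) (hM : ∀ u, |w u| ≤ M) {u : ℝ}
    (hc : ContinuousAt w u) : HasDerivAt (fun u => ∫ v in u..h, w v) (-w u) u :=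
  intervalIntegral.integral_hasDerivAt_left (intervalIntegrable_of_bound hw hM _ _)
    ⟨univ, univ_mem, hw.aestronglyMeasurable⟩ hc

end Primitive

lemma measurable_gradient (f : E d → ℝ) : Measurable (gradient f) :=
  (InnerProductSpace.toDual ℝ (E d)).symm.continuous.measurable.comp (measurable_fderiv ℝ f)

namespace IsSymmBody

lemma ae_differentiableAt_gauge (hK : IsSymmBody K) :
    ∀ᵐ x : E d, DifferentiableAt ℝ (gauge K) x := by
  obtain ⟨L, hL⟩ := hK.convex.lipschitz_gauge hK.mem_nhds
  exact hL.ae_differentiableAt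

lemma ae_dualNorm_gradient_gauge (hK : IsSymmBody K) (hd : 1 ≤ d) :
    ∀ᵐ x : E d, dualNorm K (gradient (gauge K) x) = 1 := by
  filter_upwards [hK.ae_differentiableAt_gauge, hK.ae_gauge_ne hd 0] with x hx hx0
  exact hK.dualNorm_gradient_gauge (by rintro rfl; exact hx0 gauge_zero) hx

/-- Integration by parts for `W (gauge K x)`, where `W u = ∫_u^h w` with a bounded slope `w`: this
function is Lipschitz. -/
lemma integral_primitive_mul_fderiv (hK : IsSymmBody K) (hd : 1 ≤ d) {w : ℝ → ℝ} {h M : ℝ}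
    (hw : Measurable w) (hM : ∀ u, |w u| ≤ M) (hc : ∀ u, 0 < u → u ≠ h → ContinuousAt w u)
    {φ : E d → ℝ} (hφ : ContDiff ℝ ((⊤ : ℕ∞) : WithTop ℕ∞) φ) (hφc : HasCompactSupport φ)
    (v : E d) :
    ∫ x, (∫ u in gauge K x..h, w u) * fderiv ℝ φ x v
      = - ∫ x, inner ℝ (-w (gauge K x) • gradient (gauge K) x) v * φ x := by
  have hM0 : 0 ≤ M := (abs_nonneg _).trans (hM 0)
  obtain ⟨L, hL⟩ := hK.convex.lipschitz_gauge hK.mem_nhds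
  obtain ⟨L', hL'⟩ := hφ.lipschitzWith_of_hasCompactSupport hφc (by simp)
  have hLip := (lipschitzWith_primitive (h := h) hw hM hM0).comp hL
  have h1 := hLip.integral_lineDeriv_mul_eq (μ := volume) hL' hφc v
  have h2 : ∀ x, lineDeriv ℝ φ x (-v) = - fderiv ℝ φ x v := fun x => by
    rw [(hφ.differentiable (by simp) x).lineDeriv_eq_fderiv, map_neg]
  have h3 : ∀ᵐ x, lineDeriv ℝ ((fun u => ∫ v in u..h, w v) ∘ gauge K) x v * φ x
      = inner ℝ (-w (gauge K x) • gradient (gauge K) x) v * φ x := by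
    filter_upwards [hK.ae_differentiableAt_gauge, hK.ae_gauge_ne hd 0, hK.ae_gauge_ne hd h]
      with x hx hx0 hxh
    have hd1 := (hasDerivAt_primitive (h := h) hw hM
      (hc _ ((gauge_nonneg x).lt_of_ne' hx0) hxh)).comp_hasFDerivAt x hx.hasFDerivAt
    rw [hd1.hasLineDerivAt v |>.lineDeriv, inner_smul_left, gradient,
      InnerProductSpace.toDual_symm_apply]
    simp
  rw [integral_congr_ae h3] at h1
  simp_rw [h2] at h1
  rw [h1, ← integral_neg]
  congr with x
  simp only [Function.comp]
  ring

end IsSymmBody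

/-! ### The extremal function -/

/-- The slope `g_h^{p'-1}` of the extremal function on `(0, h)`, extended by zero. -/
def extremalSlope (p : ℝ≥0∞) (K C : Set (E d)) (h : ℝ) : ℝ → ℝ :=
  (Ioo 0 h).indicator fun u => gFun K C h u ^ (conj p - 1)

/-- The radial profile `u ↦ ∫_u^h g_h^{p'-1}` of the extremal function; it vanishes for `u ≥ h`. -/
def extremalProfile (p : ℝ≥0∞) (K C : Set (E d)) (h u : ℝ) : ℝ :=
  ∫ v in u..h, extremalSlope p K C h v

/-- The weak gradient `-g_h^{p'-1}(|x|_K) ∇|x|_K` of the extremal function. -/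
def extremalGradient (p : ℝ≥0∞) (K C : Set (E d)) (h : ℝ) (x : E d) : E d :=
  -extremalSlope p K C h (gauge K x) • gradient (gauge K) x

lemma measurable_extremalSlope (p : ℝ≥0∞) (K C : Set (E d)) (h : ℝ) :
    Measurable (extremalSlope p K C h) :=
  ((measurable_gFun K C h).pow_const _).indicator measurableSet_Ioo

lemma extremalSlope_nonneg (hd : 1 ≤ d) (hm : 0 < volume.real (K ∩ (C : Set (E d))))
    (u : ℝ) : 0 ≤ extremalSlope p K C h u := by
  refine indicator_nonneg (fun u hu => ?_) u
  have := gFun_pos hd hm hu.1 hu.2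
  positivity

lemma continuousAt_extremalSlope (hd : 1 ≤ d) (hm : 0 < volume.real (K ∩ (C : Set (E d))))
    {u : ℝ} (hu : 0 < u) (huh : u ≠ h) :
    ContinuousAt (extremalSlope p K C h) u := by
  rcases lt_or_gt_of_ne huh with huh | huh
  · have hev : extremalSlope p K C h =ᶠ[𝓝 u] fun u => gFun K C h u ^ (conj p - 1) := by
      filter_upwards [Ioo_mem_nhds hu huh] with v hv
      exact indicator_of_mem hv _
    refine ContinuousAt.congr ?_ hev.symm
    refine ContinuousAt.rpow_const ?_ (Or.inl (gFun_pos hd hm hu huh).ne')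
    unfold gFun
    have : u ^ (d - 1) ≠ 0 := by positivity
    fun_prop (disch := assumption)
  · have hev : extremalSlope p K C h =ᶠ[𝓝 u] fun _ => 0 := by
      filter_upwards [Ioi_mem_nhds huh] with v hv
      exact indicator_of_notMem (fun hc => lt_asymm hc.2 hv) _
    exact continuousAt_const.congr hev.symm

/-- Near zero the slope is of order `u^{-(d-1)(p'-1)}` and `(d-1)(p'-1) < 1`. -/
lemma integrable_extremalSlope (hd : 1 ≤ d) (hp : (d : ℝ≥0∞) < p)
    (hm : 0 < volume.real (K ∩ (C : Set (E d))))
    (hh : 0 < h) : Integrable (extremalSlope p K C h) := by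
  have hd0 : (0 : ℝ) < d := by exact_mod_cast hd
  have hq := one_le_conj hd hp
  set m := volume.real (K ∩ (C : Set (E d))) with hmdef
  rw [extremalSlope, integrable_indicator_iff measurableSet_Ioo]
  have hexp : -1 < -((d - 1 : ℝ) * (conj p - 1)) := by
    have := beta_arg_pos hd hp
    have h2 : ((d : ℝ) - 1) * conj p / d < 1 := by linarith
    rw [div_lt_one hd0] at h2
    linarith
  have hi := (intervalIntegral.intervalIntegrable_rpow' hexp (a := 0) (b := h)).const_mul
    (((d * m)⁻¹) ^ (conj p - 1))
  rw [intervalIntegrable_iff_integrableOn_Ioo_of_le hh.le] at hi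
  refine hi.mono' ((measurable_gFun K C h).pow_const _).aestronglyMeasurable ?_
  filter_upwards [ae_restrict_mem measurableSet_Ioo] with u hu
  have hu0 := hu.1
  have hg := gFun_pos hd hm hu.1 hu.2
  rw [Real.norm_of_nonneg (by positivity)]
  have hle : gFun K C h u ≤ (d * m)⁻¹ * (u ^ (d - 1))⁻¹ := by
    rw [gFun_eq hd rfl hh hu0, ← mul_inv]
    refine mul_le_of_le_one_right (by positivity) ?_
    have : 0 ≤ (u / h) ^ d := by positivity
    linarith
  refine (Real.rpow_le_rpow hg.le hle (by linarith)).trans (le_of_eq ?_)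
  rw [Real.mul_rpow (by positivity) (by positivity)]
  congr 1
  rw [← Real.rpow_natCast, ← Real.rpow_neg hu0.le, ← Real.rpow_mul hu0.le, Nat.cast_sub hd,
    Nat.cast_one]
  congr 1
  ring

lemma continuous_extremalProfile (hd : 1 ≤ d) (hp : (d : ℝ≥0∞) < p)
    (hm : 0 < volume.real (K ∩ (C : Set (E d))))
    (hh : 0 < h) : Continuous (extremalProfile p K C h) := by
  have hi := integrable_extremalSlope (K := K) (C := C) hd hp hm hh
  have h1 : extremalProfile p K C h = fun u => -∫ v in h..u, extremalSlope p K C h v := by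
    ext u
    rw [extremalProfile, intervalIntegral.integral_symm]
  rw [h1]
  exact (intervalIntegral.continuous_primitive (fun a b => hi.intervalIntegrable) h).neg

lemma ofReal_extremalProfile (hd : 1 ≤ d) (hp : (d : ℝ≥0∞) < p)
    (hm : 0 < volume.real (K ∩ (C : Set (E d))))
    (hh : 0 < h) (u : ℝ) :
    ENNReal.ofReal (extremalProfile p K C h u)
      = ∫⁻ v in Ioi u, ENNReal.ofReal (extremalSlope p K C h v) := by
  have hi := integrable_extremalSlope (K := K) (C := C) hd hp hm hh
  have h0 := extremalSlope_nonneg (p := p) (h := h) hd hm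
  rw [← ofReal_integral_eq_lintegral_ofReal hi.integrableOn (Eventually.of_forall h0)]
  congr 1
  have hzero : ∀ a, h ≤ a → ∫ v in Ioi a, extremalSlope p K C h v = 0 := fun a ha =>
    setIntegral_eq_zero_of_forall_eq_zero fun v hv =>
      indicator_of_notMem (fun hc => lt_asymm hc.2 (ha.trans_lt hv)) _
  rw [extremalProfile, ← sub_zero (∫ v in Ioi u, _), ← hzero h le_rfl,
    intervalIntegral.integral_Ioi_sub_Ioi' hi.integrableOn hi.integrableOn]

lemma extremalProfile_of_le {u : ℝ} (huh : h ≤ u) : extremalProfile p K C h u = 0 := by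
  rw [extremalProfile, intervalIntegral.integral_symm, intervalIntegral.integral_of_le huh,
    setIntegral_eq_zero_of_forall_eq_zero, neg_zero]
  exact fun v hv => indicator_of_notMem (fun hc => lt_asymm hc.2 hv.1) _

lemma extremalProfile_nonneg (hd : 1 ≤ d) (hm : 0 < volume.real (K ∩ (C : Set (E d))))
    (u : ℝ) : 0 ≤ extremalProfile p K C h u := by
  rcases le_total u h with huh | huh
  · exact intervalIntegral.integral_nonneg huh fun v _ => extremalSlope_nonneg hd hm v
  · exact (extremalProfile_of_le huh).ge

lemma extremalProfile_le (hd : 1 ≤ d) (hp : (d : ℝ≥0∞) < p)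
    (hm : 0 < volume.real (K ∩ (C : Set (E d))))
    (hh : 0 < h) {u : ℝ} (hu : 0 ≤ u) :
    extremalProfile p K C h u ≤ extremalProfile p K C h 0 := by
  have hi := integrable_extremalSlope (K := K) (C := C) hd hp hm hh
  have h0 := extremalSlope_nonneg (p := p) (h := h) hd hm
  have h1 := intervalIntegral.integral_add_adjacent_intervals
    (hi.intervalIntegrable (a := 0) (b := u)) (hi.intervalIntegrable (a := u) (b := h))
  have h2 : 0 ≤ ∫ v in 0..u, extremalSlope p K C h v :=
    intervalIntegral.integral_nonneg hu fun v _ => h0 v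
  rw [extremalProfile, extremalProfile, ← h1]
  linarith

lemma extremal_eq_profile (hK : IsSymmBody K) (hh : 0 < h) {x : E d} (hx : x ∈ (C : Set (E d))) :
    extremal p K C h x = extremalProfile p K C h (gauge K x) := by
  by_cases hxK : gauge K x < h
  · have hxD : x ∈ h • K ∩ (C : Set (E d)) := ⟨(hK.mem_smul_iff hh).2 hxK, hx⟩
    rw [extremal, if_pos hxD, extremalProfile, intervalIntegral.integral_of_le hxK.le,
      intervalIntegral.integral_of_le hxK.le, integral_Ioc_eq_integral_Ioo,
      integral_Ioc_eq_integral_Ioo]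
    refine setIntegral_congr_fun measurableSet_Ioo fun u hu => ?_
    simp only [extremalSlope]
    rw [indicator_of_mem (show u ∈ Ioo 0 h from ⟨(gauge_nonneg x).trans_lt hu.1, hu.2⟩)]
  · have hxD : x ∉ h • K ∩ (C : Set (E d)) := fun hc => hxK ((hK.mem_smul_iff hh).1 hc.1)
    rw [extremal, if_neg hxD, extremalProfile_of_le (not_lt.1 hxK)]

lemma extremal_ae_eq (hK : IsSymmBody K) (hC : IsOpen (C : Set (E d))) (hh : 0 < h) :
    (fun x => extremalProfile p K C h (gauge K x)) =ᵐ[volume.restrict (C : Set (E d))]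
      extremal p K C h := by
  filter_upwards [ae_restrict_mem hC.measurableSet] with x hx
  exact (extremal_eq_profile hK hh hx).symm

lemma measurable_extremalGradient (hK : IsSymmBody K) (C : Set (E d)) :
    Measurable (extremalGradient p K C h) :=
  ((measurable_extremalSlope p K C h).comp hK.continuous_gauge.measurable).neg.smul
    (measurable_gradient _)

lemma ae_dualNorm_extremalGradient (hK : IsSymmBody K) (hd : 1 ≤ d)
    (hm : 0 < volume.real (K ∩ (C : Set (E d)))) :
    ∀ᵐ x : E d, dualNorm K (extremalGradient p K C h x) = extremalSlope p K C h (gauge K x) := by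
  filter_upwards [hK.ae_dualNorm_gradient_gauge hd] with x hx
  rw [extremalGradient, hK.dualNorm_smul, hx, mul_one, abs_neg,
    abs_of_nonneg (extremalSlope_nonneg hd hm _)]

lemma lintegral_extremalSlope_lt_top (hK : IsSymmBody K) (hd : 1 ≤ d) (hp : (d : ℝ≥0∞) < p)
    (hm : 0 < volume.real (K ∩ (C : Set (E d)))) (hh : 0 < h) :
    ∫⁻ x in (C : Set (E d)), ENNReal.ofReal (extremalSlope p K C h (gauge K x)) < ⊤ := by
  have hs := measurable_extremalSlope p K (C : Set (E d)) h
  rw [hK.lintegral_comp_gauge hd (φ := fun u => ENNReal.ofReal (extremalSlope p K C h u))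
    hs.ennreal_ofReal]
  have hi := (integrable_extremalSlope (K := K) (C := C) hd hp hm hh).lintegral_lt_top
  calc _ ≤ ∫⁻ u in Ioi (0 : ℝ), ENNReal.ofReal (d * volume.real (K ∩ (C : Set (E d))) * h ^ (d - 1))
        * ENNReal.ofReal (extremalSlope p K C h u) := by
        refine setLIntegral_mono (by fun_prop) fun u hu => ?_
        have hu0 : (0 : ℝ) < u := hu
        rcases lt_or_ge u h with huh | huh
        · gcongr
        · rw [extremalSlope, indicator_of_notMem (fun hc => not_lt.2 huh hc.2)]; simp
    _ ≤ ENNReal.ofReal (d * volume.real (K ∩ (C : Set (E d))) * h ^ (d - 1))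
        * ∫⁻ u, ENNReal.ofReal (extremalSlope p K C h u) := by
        rw [lintegral_const_mul' _ _ ENNReal.ofReal_ne_top]
        exact mul_le_mul' le_rfl (setLIntegral_le_lintegral _ _)
    _ < ⊤ := ENNReal.mul_lt_top ENNReal.ofReal_lt_top hi

lemma integrableOn_extremalGradient (hK : IsSymmBody K) (hd : 1 ≤ d) (hp : (d : ℝ≥0∞) < p)
    (hm : 0 < volume.real (K ∩ (C : Set (E d)))) (hh : 0 < h) :
    IntegrableOn (extremalGradient p K C h) (C : Set (E d)) := by
  obtain ⟨R, hR0, hR⟩ := hK.exists_norm_le_mul_dualNorm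
  have hint : IntegrableOn (fun x => extremalSlope p K C h (gauge K x)) (C : Set (E d)) := by
    refine ⟨((measurable_extremalSlope p K C h).comp
      hK.continuous_gauge.measurable).aestronglyMeasurable, ?_⟩
    rw [hasFiniteIntegral_iff_ofReal (Eventually.of_forall fun x => extremalSlope_nonneg hd hm _)]
    exact lintegral_extremalSlope_lt_top hK hd hp hm hh
  refine (hint.const_mul R).mono' (measurable_extremalGradient hK _).aestronglyMeasurable ?_
  filter_upwards [ae_restrict_of_ae (ae_dualNorm_extremalGradient (p := p) (h := h) hK hd hm)]
    with x hx
  rw [← hx]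
  exact hR _

/-- The slope may be unbounded near the origin. Truncating it at height `n` gives Lipschitz
functions, for which integration by parts holds, and dominated convergence removes the truncation.
-/
lemma isWeakGradient_extremal (hK : IsSymmBody K) (hC : IsOpen (C : Set (E d))) (hd : 1 ≤ d)
    (hp : (d : ℝ≥0∞) < p) (hm : 0 < volume.real (K ∩ (C : Set (E d)))) (hh : 0 < h) :
    IsWeakGradient C (extremal p K C h) (extremalGradient p K C h) := by
  have hs := measurable_extremalSlope p K (C : Set (E d)) h
  have hs0 := extremalSlope_nonneg (p := p) (h := h) hd hm
  have hsi := integrable_extremalSlope (K := K) (C := C) hd hp hm hh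
  have hGi := integrableOn_extremalGradient (p := p) hK hd hp hm hh
  have hFc : Continuous fun x => extremalProfile p K C h (gauge K x) :=
    (continuous_extremalProfile hd hp hm hh).comp hK.continuous_gauge
  refine IsWeakGradient.congr hC ⟨hFc.locallyIntegrable.locallyIntegrableOn _,
    hGi.locallyIntegrableOn, ?_⟩ (extremal_ae_eq hK hC hh) (ae_eq_refl _)
  intro φ hφ hφc hφC v
  let w : ℕ → ℝ → ℝ := fun n u => min (extremalSlope p K C h u) n
  have hw : ∀ n, Measurable (w n) := fun n => hs.min measurable_const
  have hw0 : ∀ n u, 0 ≤ w n u := fun n u => le_min (hs0 u) (Nat.cast_nonneg n)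
  have hwle : ∀ n u, w n u ≤ extremalSlope p K C h u := fun n u => min_le_left _ _
  have hwM : ∀ n u, |w n u| ≤ n := fun n u => by
    rw [abs_of_nonneg (hw0 n u)]; exact min_le_right _ _
  have hwc : ∀ n u, 0 < u → u ≠ h → ContinuousAt (w n) u := fun n u hu huh =>
    (continuousAt_extremalSlope hd hm hu huh).min continuousAt_const
  have hwlim : ∀ u, Tendsto (fun n => w n u) atTop (𝓝 (extremalSlope p K C h u)) := by
    intro u
    refine tendsto_const_nhds.congr' ?_
    filter_upwards [eventually_ge_atTop ⌈extremalSlope p K C h u⌉₊] with n hn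
    exact (min_eq_left (Nat.ceil_le.1 hn)).symm
  have hφz : ∀ x ∉ (C : Set (E d)), φ x = 0 := fun x hx =>
    image_eq_zero_of_notMem_tsupport fun hc => hx (hφC hc)
  have hφz' : ∀ x ∉ (C : Set (E d)), fderiv ℝ φ x = 0 := fun x hx => by
    by_contra hc; exact hx (hφC (support_fderiv_subset ℝ hc))
  have hibp : ∀ n : ℕ, ∫ x in (C : Set (E d)), (∫ u in gauge K x..h, w n u) * fderiv ℝ φ x v
      = - ∫ x in (C : Set (E d)), inner ℝ (-w n (gauge K x) • gradient (gauge K) x) v * φ x := by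
    intro n
    rw [setIntegral_eq_integral_of_forall_compl_eq_zero fun x hx => by rw [hφz' x hx]; simp,
      setIntegral_eq_integral_of_forall_compl_eq_zero fun x hx => by rw [hφz x hx, mul_zero]]
    exact hK.integral_primitive_mul_fderiv hd (hw n) (hwM n) (hwc n) hφ hφc v
  obtain ⟨M, hM⟩ := hφc.exists_bound_of_continuous hφ.continuous
  have hφ' : Continuous (fun x => fderiv ℝ φ x v) :=
    (hφ.continuous_fderiv (by simp)).clm_apply continuous_const
  have left : Tendsto (fun n : ℕ => ∫ x in (C : Set (E d)),
      (∫ u in gauge K x..h, w n u) * fderiv ℝ φ x v) atTop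
      (𝓝 (∫ x in (C : Set (E d)), extremalProfile p K C h (gauge K x) * fderiv ℝ φ x v)) := by
    refine tendsto_integral_of_dominated_convergence
      (fun x => (∫ u, extremalSlope p K C h u) * |fderiv ℝ φ x v|) (fun n => ?_) ?_ (fun n => ?_) ?_
    · exact (((lipschitzWith_primitive (hw n) (hwM n) (Nat.cast_nonneg n)).continuous.comp
        hK.continuous_gauge).mul hφ').aestronglyMeasurable
    · exact ((hφ'.integrable_of_hasCompactSupport (hφc.fderiv_apply ℝ v)).abs.const_mul
        _).integrableOn
    · refine Eventually.of_forall fun x => ?_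
      rw [norm_mul, Real.norm_eq_abs (fderiv ℝ φ x v)]
      refine mul_le_mul_of_nonneg_right ?_ (abs_nonneg _)
      refine (intervalIntegral.norm_integral_le_integral_norm_uIoc).trans ?_
      refine (setIntegral_mono_on (g := extremalSlope p K C h) ?_ hsi.integrableOn
        measurableSet_uIoc fun u _ => ?_).trans
        (setIntegral_le_integral hsi (Eventually.of_forall hs0))
      · exact (intervalIntegrable_iff.1 (intervalIntegrable_of_bound (hw n) (hwM n) _ _)).norm
      · rw [Real.norm_of_nonneg (hw0 n u)]; exact hwle n u
    · refine Eventually.of_forall fun x => Tendsto.mul_const _ ?_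
      refine intervalIntegral.tendsto_integral_filter_of_dominated_convergence
        (extremalSlope p K C h) (Eventually.of_forall fun n => (hw n).aestronglyMeasurable)
        (Eventually.of_forall fun n => Eventually.of_forall fun u _ => ?_) hsi.intervalIntegrable
        (Eventually.of_forall fun u _ => hwlim u)
      rw [Real.norm_of_nonneg (hw0 n u)]; exact hwle n u
  have right : Tendsto (fun n : ℕ => - ∫ x in (C : Set (E d)),
      inner ℝ (-w n (gauge K x) • gradient (gauge K) x) v * φ x) atTop
      (𝓝 (- ∫ x in (C : Set (E d)), inner ℝ (extremalGradient p K C h x) v * φ x)) := by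
    refine (tendsto_integral_of_dominated_convergence
      (fun x => ‖extremalGradient p K C h x‖ * ‖v‖ * M) (fun n => ?_) ?_ (fun n => ?_) ?_).neg
    · refine (Measurable.mul ?_ hφ.continuous.measurable).aestronglyMeasurable
      exact (((hw n).comp hK.continuous_gauge.measurable).neg.smul
        (measurable_gradient _)).inner measurable_const
    · exact (hGi.norm.mul_const _).mul_const _
    · refine Eventually.of_forall fun x => ?_
      rw [norm_mul]
      refine mul_le_mul ?_ (hM x) (norm_nonneg _) (by positivity)
      refine (norm_inner_le_norm _ _).trans (mul_le_mul_of_nonneg_right ?_ (norm_nonneg _))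
      rw [extremalGradient, norm_smul, norm_smul, norm_neg, norm_neg, Real.norm_of_nonneg (hw0 _ _),
        Real.norm_of_nonneg (hs0 _)]
      exact mul_le_mul_of_nonneg_right (hwle _ _) (norm_nonneg _)
    · refine Eventually.of_forall fun x => Tendsto.mul_const _ ?_
      exact ((hwlim _).neg.smul_const _).inner tendsto_const_nhds
  exact tendsto_nhds_unique left (by simpa only [hibp] using right)

/-! ### The norms of the extremal function -/

lemma gradNorm_extremalGradient (hK : IsSymmBody K) (hC : IsOpen (C : Set (E d))) (hd : 1 ≤ d)
    (hp : (d : ℝ≥0∞) < p) (hm : 0 < volume.real (K ∩ (C : Set (E d)))) (hh : 0 < h) :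
    gradNorm K C p (extremalGradient p K C h) = (∫⁻ u in Ioo 0 h,
      ENNReal.ofReal (d * volume.real (K ∩ (C : Set (E d))) * u ^ (d - 1))
        * ENNReal.ofReal (gFun K C h u) ^ conj p) ^ recip p := by
  have hs := measurable_extremalSlope p K (C : Set (E d)) h
  have hp0 : p ≠ 0 := (pos_of_gt hp).ne'
  have hDm : MeasurableSet (h • K ∩ (C : Set (E d))) := (hK.isOpen_smul_inter hC hh).measurableSet
  rw [gradNorm, eLpNorm_congr_ae (ae_restrict_of_ae
    (ae_dualNorm_extremalGradient (p := p) (h := h) hK hd hm))]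
  have hq := conj_mul_one_sub_recip hd hp
  rcases eq_or_ne p ⊤ with rfl | hpt
  · have hr : recip ⊤ = 0 := by simp [recip]
    have hq1 : conj ⊤ = 1 := by simp [conj, hr]
    have hae : (fun x => extremalSlope ⊤ K C h (gauge K x)) =ᵐ[volume.restrict (C : Set (E d))]
        (h • K ∩ (C : Set (E d))).indicator fun _ => (1 : ℝ) := by
      filter_upwards [ae_restrict_mem hC.measurableSet, ae_restrict_of_ae (hK.ae_gauge_ne hd 0)]
        with x hx hx0
      have h0 : 0 < gauge K x := (gauge_nonneg x).lt_of_ne' hx0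
      by_cases hxK : gauge K x < h
      · rw [extremalSlope, indicator_of_mem (show gauge K x ∈ Ioo 0 h from ⟨h0, hxK⟩),
          indicator_of_mem (show x ∈ h • K ∩ (C : Set (E d)) from ⟨(hK.mem_smul_iff hh).2 hxK, hx⟩),
          hq1, sub_self, Real.rpow_zero]
      · rw [extremalSlope, indicator_of_notMem (fun hc => hxK hc.2),
          indicator_of_notMem (fun hc => hxK ((hK.mem_smul_iff hh).1 hc.1))]
    rw [eLpNorm_congr_ae hae, eLpNorm_indicator_const' hDm ?_ (by simp), hr]
    · simp
    · rw [Measure.restrict_apply hDm, inter_assoc, inter_self, hK.volume_smul_inter hd hh]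
      simp
      positivity
  · have hr : recip p = 1 / p.toReal := by rw [recip, ENNReal.toReal_inv, one_div]
    have hp' : 0 < p.toReal := ENNReal.toReal_pos hp0 hpt
    have hexp : (conj p - 1) * p.toReal = conj p := by
      rw [hr] at hq
      field_simp at hq
      linarith
    rw [eLpNorm_eq_lintegral_rpow_enorm_toReal hp0 hpt, ← hr,
      hK.lintegral_comp_gauge hd (φ := fun u => ‖extremalSlope p K C h u‖ₑ ^ p.toReal)
        (hs.enorm.pow_const _)]
    congr 1
    rw [show Ioo (0 : ℝ) h = Iio h ∩ Ioi 0 from (Iio_inter_Ioi).symm,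
      ← Measure.restrict_restrict measurableSet_Iio, ← lintegral_indicator measurableSet_Iio]
    refine setLIntegral_congr_fun measurableSet_Ioi fun u hu => ?_
    have hu0 : (0 : ℝ) < u := hu
    by_cases huh : u < h
    · have hg := gFun_pos hd hm hu0 huh
      simp only [extremalSlope]
      rw [indicator_of_mem (show u ∈ Ioo 0 h from ⟨hu0, huh⟩),
        indicator_of_mem (show u ∈ Iio h from huh), Real.enorm_eq_ofReal (by positivity),
        ← ENNReal.ofReal_rpow_of_pos hg, ← ENNReal.rpow_mul, hexp]
    · simp only [extremalSlope]
      rw [indicator_of_notMem (fun hc : u ∈ Ioo 0 h => huh hc.2),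
        indicator_of_notMem (fun hc : u ∈ Iio h => huh hc), enorm_zero,
        ENNReal.zero_rpow_of_pos hp', mul_zero]

lemma gradNorm_extremalGradient_lt_top (hK : IsSymmBody K) (hC : IsOpen (C : Set (E d)))
    (hd : 1 ≤ d) (hp : (d : ℝ≥0∞) < p) (hm : 0 < volume.real (K ∩ (C : Set (E d))))
    (hh : 0 < h) : gradNorm K C p (extremalGradient p K C h) < ⊤ := by
  rw [gradNorm_extremalGradient hK hC hd hp hm hh, lintegral_gFun_rpow hd hp hh hm]
  exact ENNReal.rpow_lt_top_of_nonneg (recip_nonneg p) ENNReal.ofReal_ne_top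

lemma memSobolev_extremal (hK : IsSymmBody K) (hC : IsOpen (C : Set (E d))) (hd : 1 ≤ d)
    (hp : (d : ℝ≥0∞) < p) (hm : 0 < volume.real (K ∩ (C : Set (E d)))) (hh : 0 < h) :
    MemSobolev C p (extremal p K C h) := by
  refine ⟨_, isWeakGradient_extremal hK hC hd hp hm hh, ?_⟩
  have hmeas := measurable_extremalGradient (p := p) (h := h) hK (C : Set (E d))
  obtain ⟨R, hR0, hR⟩ := hK.exists_norm_le_mul_dualNorm
  have hN : MemLp (fun x => dualNorm K (extremalGradient p K C h x)) p
      (volume.restrict (C : Set (E d))) :=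
    ⟨(hK.continuous_dualNorm.measurable.comp hmeas).aestronglyMeasurable,
      gradNorm_extremalGradient_lt_top hK hC hd hp hm hh⟩
  refine hN.of_le_mul (c := R) hmeas.aestronglyMeasurable (Eventually.of_forall fun x => ?_)
  rw [Real.norm_of_nonneg (hK.dualNorm_nonneg _)]
  exact hR _

/-- The extremal function attains its supremum at the apex of the cone. -/
lemma supNorm_extremal (hK : IsSymmBody K) (hC : IsOpen (C : Set (E d)))
    (hCn : (C : Set (E d)).Nonempty) (hd : 1 ≤ d) (hp : (d : ℝ≥0∞) < p) (hh : 0 < h) :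
    supNorm C (extremal p K C h) = ENNReal.ofReal (extremalProfile p K C h 0) := by
  have hm := hK.volumeReal_inter_pos hC hCn
  have hFc : Continuous (extremalProfile p K C h) := continuous_extremalProfile hd hp hm hh
  have hcont : Continuous fun x => ‖extremalProfile p K C h (gauge K x)‖ₑ :=
    (hFc.comp hK.continuous_gauge).enorm
  rw [← supNorm_congr (extremal_ae_eq hK hC hh), supNorm, eLpNorm_exponent_top]
  refine le_antisymm (essSup_le_of_ae_le _ (Eventually.of_forall fun x => ?_)) ?_
  · simp only []
    rw [Real.enorm_eq_ofReal (extremalProfile_nonneg hd hm _)]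
    exact ENNReal.ofReal_le_ofReal (extremalProfile_le hd hp hm hh (gauge_nonneg x))
  · set B := eLpNormEssSup (fun x => extremalProfile p K C h (gauge K x))
      (volume.restrict (C : Set (E d))) with hB
    have hae := ae_le_eLpNormEssSup (f := fun x => extremalProfile p K C h (gauge K x))
      (μ := volume.restrict (C : Set (E d)))
    rw [ae_restrict_iff' hC.measurableSet] at hae
    have hall : ∀ x ∈ (C : Set (E d)), ‖extremalProfile p K C h (gauge K x)‖ₑ ≤ B := by
      have hopen : IsOpen ((C : Set (E d)) ∩ {x | B < ‖extremalProfile p K C h (gauge K x)‖ₑ}) :=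
        hC.inter (isOpen_lt continuous_const hcont)
      have hnull :
          volume ((C : Set (E d)) ∩ {x | B < ‖extremalProfile p K C h (gauge K x)‖ₑ}) = 0 :=
        measure_eq_zero_iff_ae_notMem.2 (hae.mono fun x hx hc => not_lt.2 (hx hc.1) hc.2)
      have hempty := hopen.eq_empty_of_measure_zero hnull
      intro x hx
      by_contra hc
      have : x ∈ (C : Set (E d)) ∩ {x | B < ‖extremalProfile p K C h (gauge K x)‖ₑ} :=
        ⟨hx, not_le.1 hc⟩
      rw [hempty] at this
      exact this
    obtain ⟨c, hc⟩ := hCn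
    have hlim : Tendsto (fun t : ℝ => ‖extremalProfile p K C h (gauge K (t • c))‖ₑ) (𝓝[>] 0)
        (𝓝 ‖extremalProfile p K C h (gauge K ((0 : ℝ) • c))‖ₑ) :=
      Tendsto.mono_left (Continuous.tendsto (hcont.comp (by fun_prop : Continuous fun t : ℝ =>
        t • c)) 0) nhdsWithin_le_nhds
    rw [zero_smul, gauge_zero, Real.enorm_eq_ofReal (extremalProfile_nonneg hd hm _)] at hlim
    refine le_of_tendsto hlim ?_
    filter_upwards [self_mem_nhdsWithin] with t ht
    exact hall _ (C.smul_mem ht hc)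

/-- By the layer-cake formula, `∫_C f_{e,h} = μ(K ∩ C) ∫_0^h g_h^{p'-1}(v) v^d dv`. -/
lemma lintegral_extremal (hK : IsSymmBody K) (hC : IsOpen (C : Set (E d))) (hd : 1 ≤ d)
    (hp : (d : ℝ≥0∞) < p) (hm : 0 < volume.real (K ∩ (C : Set (E d)))) (hh : 0 < h) :
    ∫⁻ x in (C : Set (E d)), ENNReal.ofReal (extremal p K C h x) = ∫⁻ v in Ioo 0 h,
      ENNReal.ofReal (gFun K C h v ^ (conj p - 1))
        * ENNReal.ofReal (v ^ d * volume.real (K ∩ (C : Set (E d)))) := by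
  have hs := measurable_extremalSlope p K (C : Set (E d)) h
  have hg := hK.continuous_gauge.measurable
  have h1 : ∫⁻ x in (C : Set (E d)), ENNReal.ofReal (extremal p K C h x)
      = ∫⁻ x in (C : Set (E d)), ∫⁻ v, {q : E d × ℝ | gauge K q.1 < q.2}.indicator
        (fun q => ENNReal.ofReal (extremalSlope p K C h q.2)) (x, v) := by
    refine setLIntegral_congr_fun hC.measurableSet fun x hx => ?_
    rw [extremal_eq_profile hK hh hx, ofReal_extremalProfile hd hp hm hh,
      ← lintegral_indicator measurableSet_Ioi]
    exact lintegral_congr fun v => rfl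
  have hmeas : Measurable (Function.uncurry fun (x : E d) (v : ℝ) =>
      {q : E d × ℝ | gauge K q.1 < q.2}.indicator
        (fun q => ENNReal.ofReal (extremalSlope p K C h q.2)) (x, v)) :=
    (hs.comp measurable_snd).ennreal_ofReal.indicator
      (measurableSet_lt (hg.comp measurable_fst) measurable_snd)
  rw [h1, lintegral_lintegral_swap hmeas.aemeasurable, ← lintegral_indicator measurableSet_Ioo]
  refine lintegral_congr fun v => ?_
  have hset : MeasurableSet {x : E d | gauge K x < v} := measurableSet_lt hg measurable_const
  have h2 : ∫⁻ x in (C : Set (E d)), {q : E d × ℝ | gauge K q.1 < q.2}.indicator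
      (fun q => ENNReal.ofReal (extremalSlope p K C h q.2)) (x, v)
      = ∫⁻ x in (C : Set (E d)), {x : E d | gauge K x < v}.indicator
        (fun _ => ENNReal.ofReal (extremalSlope p K C h v)) x := lintegral_congr fun x => rfl
  rw [h2, lintegral_indicator_const hset, Measure.restrict_apply hset, hK.volume_gauge_lt hd]
  by_cases hv : v ∈ Ioo 0 h
  · rw [indicator_of_mem hv, extremalSlope, indicator_of_mem hv, ← ENNReal.ofReal_pow hv.1.le,
      ENNReal.ofReal_mul (pow_nonneg hv.1.le d), ofReal_measureReal hK.volume_inter_lt_top.ne]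
  · rw [indicator_of_notMem hv, extremalSlope, indicator_of_notMem hv, ENNReal.ofReal_zero,
      zero_mul]

lemma lintegral_extremal_lt_top (hK : IsSymmBody K) (hC : IsOpen (C : Set (E d))) (hd : 1 ≤ d)
    (hp : (d : ℝ≥0∞) < p) (hm : 0 < volume.real (K ∩ (C : Set (E d)))) (hh : 0 < h) :
    ∫⁻ x in (C : Set (E d)), ENNReal.ofReal (extremal p K C h x) < ⊤ := by
  have hi := (integrable_extremalSlope (K := K) (C := C) hd hp hm hh).lintegral_lt_top
  rw [lintegral_extremal hK hC hd hp hm hh]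
  refine lt_of_le_of_lt (b := ∫⁻ v in Ioo 0 h, ENNReal.ofReal (extremalSlope p K C h v)
    * ENNReal.ofReal (h ^ d * volume.real (K ∩ (C : Set (E d))))) ?_ ?_
  · refine setLIntegral_mono' measurableSet_Ioo fun v hv => ?_
    rw [extremalSlope, indicator_of_mem hv]
    have := hv.1.le
    have := hv.2.le
    gcongr
  · rw [lintegral_mul_const' _ _ ENNReal.ofReal_ne_top]
    exact ENNReal.mul_lt_top ((setLIntegral_le_lintegral _ _).trans_lt hi) ENNReal.ofReal_lt_top

/-- Equality in the additive inequality, where `T` is the mass of the extremal function: since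
`d μ(K ∩ C) u^{d-1} g_h(u) = 1 - (u/h)^d`, the two summands are the integrals of
`g_h^{p'-1}(u) (1 - (u/h)^d)` and `g_h^{p'-1}(u) (u/h)^d`. -/
lemma extremalProfile_eq_additiveBound (hK : IsSymmBody K) (hC : IsOpen (C : Set (E d)))
    (hd : 1 ≤ d) (hp : (d : ℝ≥0∞) < p) (hm : 0 < volume.real (K ∩ (C : Set (E d))))
    (hh : 0 < h) :
    ENNReal.ofReal (extremalProfile p K C h 0)
      = additiveBound p K C h (gradNorm K C p (extremalGradient p K C h))
        (∫⁻ x in (C : Set (E d)), ENNReal.ofReal (extremal p K C h x)) := by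
  have hs := measurable_extremalSlope p K (C : Set (E d)) h
  have hgm := measurable_gFun K (C : Set (E d)) h
  have hA := constA_pos hd hp
  have hq0 := conj_pos hd hp
  have hI := lintegral_gFun_rpow hd hp hh hm
  rw [additiveBound, gradNorm_extremalGradient hK hC hd hp hm hh,
    lintegral_extremal hK hC hd hp hm hh, ofReal_extremalProfile hd hp hm hh]
  set m := volume.real (K ∩ (C : Set (E d))) with hmdef
  set I := ∫⁻ u in Ioo 0 h, ENNReal.ofReal (d * m * u ^ (d - 1))
        * ENNReal.ofReal (gFun K C h u) ^ conj p with hIdef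
  set c := constA d p * m ^ (-recip p) * h ^ (1 - d * recip p) with hc
  have hc0 : 0 < c := by positivity
  have hcI : ENNReal.ofReal c * I ^ recip p = I := by
    have e : ENNReal.ofReal c = I ^ (1 / conj p) := by
      rw [hI, ENNReal.ofReal_rpow_of_nonneg (by positivity) (by positivity),
        ← Real.rpow_mul hc0.le, mul_one_div_cancel hq0.ne', Real.rpow_one]
    have hI0 : I ≠ 0 := by rw [hI]; simp; positivity
    have hIt : I ≠ ⊤ := by rw [hI]; exact ENNReal.ofReal_ne_top
    rw [e, ← ENNReal.rpow_add _ _ hI0 hIt, one_div_conj, sub_add_cancel, ENNReal.rpow_one]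
  have e1 : ∫⁻ v in Ioi (0 : ℝ), ENNReal.ofReal (extremalSlope p K C h v)
      = ∫⁻ v in Ioo 0 h, ENNReal.ofReal (gFun K C h v ^ (conj p - 1)) := by
    rw [show Ioo (0 : ℝ) h = Iio h ∩ Ioi 0 from (Iio_inter_Ioi).symm,
      ← Measure.restrict_restrict measurableSet_Iio, ← lintegral_indicator measurableSet_Iio]
    refine setLIntegral_congr_fun measurableSet_Ioi fun v hv => ?_
    by_cases hvh : v < h
    · simp only [extremalSlope]
      rw [indicator_of_mem (show v ∈ Ioo 0 h from ⟨hv, hvh⟩),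
        indicator_of_mem (show v ∈ Iio h from hvh)]
    · simp only [extremalSlope]
      rw [indicator_of_notMem (fun hc : v ∈ Ioo 0 h => hvh hc.2),
        indicator_of_notMem (fun hc : v ∈ Iio h => hvh hc), ENNReal.ofReal_zero]
  rw [hcI, e1, ← lintegral_const_mul' _ _ ENNReal.ofReal_ne_top, hIdef,
    ← lintegral_add_left (by fun_prop)]
  refine setLIntegral_congr_fun measurableSet_Ioo fun u hu => ?_
  have hu0 := hu.1
  have hg := gFun_pos hd hm hu.1 hu.2
  have hdens := density_mul_gFun hd hm hh hu0
  rw [← hmdef] at hdens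
  rw [ENNReal.ofReal_rpow_of_pos hg, ← ENNReal.ofReal_mul (by positivity),
    ← ENNReal.ofReal_mul (by positivity), ← ENNReal.ofReal_mul (by positivity),
    ← ENNReal.ofReal_add (by positivity) (by positivity)]
  congr 1
  have e2 : gFun K C h u ^ conj p = gFun K C h u * gFun K C h u ^ (conj p - 1) := by
    rw [← Real.rpow_one_add' hg.le (by linarith), add_sub_cancel]
  rw [e2, ← mul_assoc, hdens, div_pow]
  field_simp
  ring

/-! ### Charges with the extremal density -/

/-- The charge `A ↦ ∫_{A ∩ U} f` of a density that is integrable on `U`. Intersecting with `U` only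
affects sets outside the domain of the charge, for which the integral could be a junk value. -/
def Charge.ofIntegrable {U : Set (E d)} (hU : MeasurableSet U) (f : E d → ℝ)
    (hf : IntegrableOn f U) : Charge U where
  val A := ((∫ x in A ∩ U, f x : ℝ) : EReal)
  val_empty := by simp
  hasSum_iUnion A hA hAU hdisj := by
    have hs := hasSum_integral_iUnion_ae (μ := volume) (f := f) (s := fun n => A n ∩ U)
      (fun n => (hA n).inter hU.nullMeasurableSet)
      (fun i j hij => ((hdisj hij).mono inter_subset_left inter_subset_left).aedisjoint)
      (hf.mono_set (iUnion_subset fun n => inter_subset_right))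
    rw [← iUnion_inter] at hs
    exact hs.map (⟨⟨Real.toEReal, EReal.coe_zero⟩, EReal.coe_add⟩ : ℝ →+ EReal)
      continuous_coe_real_ereal
  omits := Or.inl fun A _ _ => EReal.coe_ne_bot _

lemma Charge.isReal_ofIntegrable {U : Set (E d)} (hU : MeasurableSet U) (f : E d → ℝ)
    (hf : IntegrableOn f U) : (Charge.ofIntegrable hU f hf).IsReal :=
  fun _ _ _ => ⟨EReal.coe_ne_bot _, EReal.coe_ne_top _⟩

lemma Charge.isRNDeriv_ofIntegrable {U : Set (E d)} (hU : MeasurableSet U) (f : E d → ℝ)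
    (hf : IntegrableOn f U) : (Charge.ofIntegrable hU f hf).IsRNDeriv f := by
  refine ⟨hf.aemeasurable, fun A _ hAU => ?_⟩
  have hfA := hf.mono_set hAU
  have hP : ∫⁻ x in A, ENNReal.ofReal (f x) ≠ ⊤ := hfA.lintegral_lt_top.ne
  have hM : ∫⁻ x in A, ENNReal.ofReal (-f x) ≠ ⊤ := hfA.neg.lintegral_lt_top.ne
  change ((∫ x in A ∩ U, f x : ℝ) : EReal) = _
  rw [inter_eq_left.2 hAU, integral_eq_lintegral_pos_part_sub_lintegral_neg_part hfA,
    EReal.coe_sub, EReal.coe_ennreal_toReal hP, EReal.coe_ennreal_toReal hM]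

lemma Charge.IsRNDeriv.isAbsCont {U : Set (E d)} {ν : Charge U} {f : E d → ℝ}
    (hν : ν.IsRNDeriv f) : ν.IsAbsCont := by
  intro A hA h0
  rw [hν.2 A (NullMeasurableSet.of_null h0) hA, Measure.restrict_eq_zero.2 h0]
  simp

lemma Charge.IsRNDeriv.abs_val {U : Set (E d)} {ν : Charge U} {f : E d → ℝ}
    (hν : ν.IsRNDeriv f) (hf : ∀ x, 0 ≤ f x) {A : Set (E d)} (hA : NullMeasurableSet A volume)
    (hAU : A ⊆ U) : (ν.val A).abs = ∫⁻ x in A, ENNReal.ofReal (f x) := by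
  have h0 : ∀ x, ENNReal.ofReal (-f x) = 0 := fun x =>
    ENNReal.ofReal_of_nonpos (neg_nonpos.2 (hf x))
  rw [hν.2 A hA hAU]
  simp only [h0, lintegral_zero, EReal.coe_ennreal_zero, sub_zero]
  rcases eq_or_ne (∫⁻ x in A, ENNReal.ofReal (f x)) ⊤ with h | h
  · rw [h]; rfl
  · rw [← EReal.coe_ennreal_toReal h, EReal.abs_def, abs_of_nonneg ENNReal.toReal_nonneg,
      ENNReal.ofReal_toReal h]

lemma extremal_nonneg (hd : 1 ≤ d) (hm : 0 < volume.real (K ∩ (C : Set (E d)))) (x : E d)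
    (hK : IsSymmBody K) (hh : 0 < h) : 0 ≤ extremal p K C h x := by
  by_cases hx : x ∈ (C : Set (E d))
  · rw [extremal_eq_profile hK hh hx]
    exact extremalProfile_nonneg hd hm _
  · rw [extremal, if_neg fun hc => hx hc.2]

/-- The seminorms of a charge with nonnegative density supported in `hK ∩ C` are all at most its
total mass, and translating `hK ∩ C` towards the apex exhausts that mass. -/
lemma seminormAt_eq_seminorm_eq (hK : IsSymmBody K) (hC : IsOpen (C : Set (E d)))
    (hCn : (C : Set (E d)).Nonempty) (hd : 1 ≤ d) (hh : 0 < h)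
    {ν : Charge (C : Set (E d))} (hν : ν.IsRNDeriv (extremal p K C h)) :
    ν.seminormAt K h = ∫⁻ x in (C : Set (E d)), ENNReal.ofReal (extremal p K C h x) ∧
    ν.seminorm K = ∫⁻ x in (C : Set (E d)), ENNReal.ofReal (extremal p K C h x) := by
  have hm := hK.volumeReal_inter_pos hC hCn
  have hf0 := fun x => extremal_nonneg (p := p) hd hm x hK hh
  set T := ∫⁻ x in (C : Set (E d)), ENNReal.ofReal (extremal p K C h x) with hT
  have hDo : ∀ r : ℝ, 0 < r → IsOpen (r • K ∩ (C : Set (E d))) := fun r hr =>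
    hK.isOpen_smul_inter hC hr
  have habs : ∀ r : ℝ, 0 < r → ∀ x ∈ (C : Set (E d)), (ν.val (x +ᵥ (r • K ∩ (C : Set (E d))))).abs
      = ∫⁻ y in x +ᵥ (r • K ∩ (C : Set (E d))), ENNReal.ofReal (extremal p K C h y) :=
    fun r hr x hx => hν.abs_val hf0 ((hDo r hr).measurableSet.const_vadd x).nullMeasurableSet
      (vadd_smul_inter_subset hx r)
  have hle : ∀ r : ℝ, 0 < r → ν.seminormAt K r ≤ T := fun r hr => iSup₂_le fun x hx => by
    rw [habs r hr x hx]
    exact lintegral_mono_set (vadd_smul_inter_subset hx r)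
  have hge : T ≤ ν.seminormAt K h := by
    obtain ⟨c, hc⟩ := hCn
    let t : ℕ → ℝ := fun n => 1 / ((n : ℝ) + 1)
    have ht0 : ∀ n, 0 < t n := fun n => Nat.one_div_pos_of_nat
    have htlim : Tendsto t atTop (𝓝 0) := tendsto_one_div_add_atTop_nhds_zero_nat
    let A : ℕ → Set (E d) := fun n => t n • c +ᵥ (h • K ∩ (C : Set (E d)))
    have hAm : ∀ n, MeasurableSet (A n) := fun n => (hDo h hh).measurableSet.const_vadd _
    have hAC : ∀ n, A n ⊆ C := fun n => vadd_smul_inter_subset (C.smul_mem (ht0 n) hc) h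
    have hmeas : AEMeasurable (fun x => ENNReal.ofReal (extremal p K C h x))
        (volume.restrict (C : Set (E d))) := hν.1.ennreal_ofReal
    have hpt : ∀ x ∈ (C : Set (E d)), ENNReal.ofReal (extremal p K C h x)
        ≤ liminf (fun n => (A n).indicator (fun x => ENNReal.ofReal (extremal p K C h x)) x)
          atTop := by
      intro x hx
      by_cases hxD : x ∈ h • K ∩ (C : Set (E d))
      · have hlim : Tendsto (fun n => x - t n • c) atTop (𝓝 x) := by
          simpa using tendsto_const_nhds.sub (htlim.smul_const c)
        refine le_liminf_of_le (by isBoundedDefault) ?_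
        filter_upwards [hlim.eventually ((hDo h hh).mem_nhds hxD)] with n hn
        rw [indicator_of_mem]
        exact ⟨x - t n • c, hn, by simp⟩
      · rw [extremal, if_neg hxD, ENNReal.ofReal_zero]
        exact zero_le
    calc T ≤ ∫⁻ x in (C : Set (E d)), liminf (fun n => (A n).indicator
          (fun x => ENNReal.ofReal (extremal p K C h x)) x) atTop :=
          setLIntegral_mono' hC.measurableSet hpt
      _ ≤ liminf (fun n => ∫⁻ x in (C : Set (E d)), (A n).indicator
          (fun x => ENNReal.ofReal (extremal p K C h x)) x) atTop :=
          lintegral_liminf_le' fun n => hmeas.indicator (hAm n)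
      _ ≤ ν.seminormAt K h := by
          refine liminf_le_of_le (by isBoundedDefault) fun b hb => ?_
          obtain ⟨n, hn⟩ := hb.exists
          refine hn.trans ?_
          rw [lintegral_indicator (hAm n), Measure.restrict_restrict (hAm n),
            inter_eq_left.2 (hAC n), ← habs h hh _ (C.smul_mem (ht0 n) hc)]
          exact le_iSup₂_of_le (f := fun x (_ : x ∈ (C : Set (E d))) =>
            (ν.val (x +ᵥ (h • K ∩ (C : Set (E d))))).abs) _ (C.smul_mem (ht0 n) hc) le_rfl
  exact ⟨le_antisymm (hle h hh) hge, le_antisymm (iSup₂_le hle)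
    (hge.trans (ν.seminormAt_le_seminorm K hh))⟩

end ChargeNagy
end

open ChargeNagy
theorem theorem3 (d : ℕ) (hd : 1 ≤ d) (p : ℝ≥0∞) (hp : (d : ℝ≥0∞) < p)
    (K : Set (E d)) (hKo : IsOpen K) (hKc : Convex ℝ K) (hKb : Bornology.IsBounded K)
    (hKs : ∀ x ∈ K, -x ∈ K) (hK0 : (0 : E d) ∈ K)
    (C : ConvexCone ℝ (E d)) (hCo : IsOpen (C : Set (E d))) (hCn : (C : Set (E d)).Nonempty) :
    -- the additive inequality
    (∀ h : ℝ, 0 < h → ∀ ν : Charge (C : Set (E d)), ν.IsAbsCont → ν.seminormAt K h < ⊤ →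
      ∀ f : E d → ℝ, ν.IsRNDeriv f → MemSobolev C p f → ∀ G : E d → E d, IsWeakGradient C f G →
        supNorm C f ≤ additiveBound p K C h (gradNorm K C p G) (ν.seminormAt K h)) ∧
    -- the multiplicative inequality
    (∀ ν : Charge (C : Set (E d)), ν.IsAbsCont → ν.seminorm K < ⊤ →
      ∀ f : E d → ℝ, ν.IsRNDeriv f → MemSobolev C p f → ∀ G : E d → E d, IsWeakGradient C f G →
        supNorm C f ≤ multiplicativeBound p K C (gradNorm K C p G) (ν.seminorm K)) ∧
    -- sharpness: the charges with density `f_{e,h}` are admissible and give equality in both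
    (∀ h : ℝ, 0 < h →
      MemSobolev C p (extremal p K C h) ∧
      0 < supNorm C (extremal p K C h) ∧ supNorm C (extremal p K C h) < ⊤ ∧
      (∃ ν : Charge (C : Set (E d)), ν.IsReal ∧ ν.IsRNDeriv (extremal p K C h)) ∧
      ∀ ν : Charge (C : Set (E d)), ν.IsRNDeriv (extremal p K C h) →
        ν.IsAbsCont ∧ ν.seminormAt K h < ⊤ ∧ ν.seminorm K < ⊤ ∧
        ∀ G : E d → E d, IsWeakGradient C (extremal p K C h) G →
          gradNorm K C p G < ⊤ ∧
          supNorm C (extremal p K C h)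
            = additiveBound p K C h (gradNorm K C p G) (ν.seminormAt K h) ∧
          supNorm C (extremal p K C h)
            = multiplicativeBound p K C (gradNorm K C p G) (ν.seminorm K)) := by
  have hK : IsSymmBody K := ⟨hKo, hKc, hKb, hKs, hK0⟩
  have hm := hK.volumeReal_inter_pos hCo hCn
  refine ⟨fun h hh ν _ hS f hν _ G hG => supNorm_le_additiveBound hK hCo hCn hd hp hh hS hν hG,
    fun ν _ hS f hν hf G hG => supNorm_le_multiplicativeBound hK hCo hCn hd hp hS hν hf hG,
    fun h hh => ?_⟩
  have hT := lintegral_extremal_lt_top hK hCo hd hp hm hh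
  have hsup := supNorm_extremal hK hCo hCn hd hp hh
  have hadd := extremalProfile_eq_additiveBound hK hCo hd hp hm hh
  have hweak := isWeakGradient_extremal hK hCo hd hp hm hh
  have hmem := memSobolev_extremal hK hCo hd hp hm hh
  refine ⟨hmem, ?_, ?_, ?_, fun ν hν => ?_⟩
  · -- the gradient term of the additive bound is already positive
    rw [hsup, hadd, additiveBound, gradNorm_extremalGradient hK hCo hd hp hm hh,
      lintegral_gFun_rpow hd hp hh hm]
    have hA := constA_pos hd hp
    refine lt_of_lt_of_le (ENNReal.mul_pos ?_ ?_) le_self_add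
    · simp only [ne_eq, ENNReal.ofReal_eq_zero, not_le]; positivity
    · refine (ENNReal.rpow_pos ?_ ENNReal.ofReal_ne_top).ne'
      rw [ENNReal.ofReal_pos]
      positivity
  · rw [hsup]; exact ENNReal.ofReal_lt_top
  · have hint : IntegrableOn (extremal p K C h) (C : Set (E d)) := by
      refine ⟨hweak.1.aestronglyMeasurable, ?_⟩
      rw [hasFiniteIntegral_iff_ofReal (Filter.Eventually.of_forall fun x =>
        extremal_nonneg hd hm x hK hh)]
      exact hT
    exact ⟨Charge.ofIntegrable hCo.measurableSet _ hint, Charge.isReal_ofIntegrable _ _ _,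
      Charge.isRNDeriv_ofIntegrable _ _ _⟩
  · obtain ⟨hat, hall⟩ := seminormAt_eq_seminorm_eq hK hCo hCn hd hh hν
    refine ⟨hν.isAbsCont, hat ▸ hT, hall ▸ hT, fun G hG => ?_⟩
    have hGN : gradNorm K C p G = gradNorm K C p (extremalGradient p K C h) :=
      gradNorm_congr (hG.ae_eq hCo hweak)
    have hN : gradNorm K C p G < ⊤ := by
      rw [hGN]; exact gradNorm_extremalGradient_lt_top hK hCo hd hp hm hh
    have heq : supNorm C (extremal p K C h)
        = additiveBound p K C h (gradNorm K C p G) (ν.seminormAt K h) := by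
      rw [hsup, hadd, hGN, hat]
    refine ⟨hN, heq, le_antisymm
      (supNorm_le_multiplicativeBound hK hCo hCn hd hp (hall ▸ hT) hν hmem hG) ?_⟩
    -- the multiplicative bound lies below every additive bound, and the two seminorms agree
    rw [heq, hat, hall]
    exact multiplicativeBound_le_additiveBound hd hp hm hh hN.ne hT.ne
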